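/- **Setting.** An *instance* consists of $n$ arms with reward distributions on $[0,1]$ such that one arm, the *best arm*, has a strictly larger mean than all others. Each pull of an arm yields an independent sample from its distribution. A *centralized* fixed-time algorithm is a (possibly randomized) sequential, adaptive algorithm that, given a time budget $T\in\mathbb N$, makes at most $T$ pulls and outputs an arm. A *non-adaptive collaborative* fixed-time algorithm with $K$ agents is a (possibly randomized) algorithm that, given a time budget $T\in\mathbb N$, proceeds in rounds: at the beginning of each round every agent that has not terminated fixes an ordered list of arms to pull, as a function of the randomness and of what it knows (the outcomes of the pulls of all agents in previous rounds, which are broadcast between rounds); after making these pulls it either terminates and outputs an arm, or requests a communication step. The number of rounds is the number of communication steps plus one (the number of rounds until all agents have terminated), and the running time, the sum over the rounds of the maximum number of pulls made by an agent in the round, must be at most $T$. The algorithm errs unless all agents output the best arm. Let $\delta_{\mathcal A}(I,T)$ denote the error probability of $\mathcal A$ on the instance $I$ with time budget $T$. We say that $(\mathcal A,T')$ *dominates* $(\mathcal O,T)$, written $(\mathcal A,T')\succcurlyeq(\mathcal O,T)$, if $\delta_{\mathcal A}(I,T')\le\delta_{\mathcal O}(I,T)$ for every instance $I$. The *speedup*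 of a collaborative algorithm $\mathcal A$ is $$\beta_{\mathcal A}=\inf_{T\ge 1}\ \inf_{\mathcal O\text{ centralized}}\ \sup_{T'\,:\,(\mathcal A,T')\succcurlyeq(\mathcal O,T)}\frac{T}{T'}\qquad(\sup\emptyset=0,\ T/0=\infty).$$ **Theorem.** There is a universal constant $c>0$ such that the following holds for all integers $n\ge 3$ and $K\ge 1$, every real $\alpha\in[1,n^{0.2}]$ and every randomized non-adaptive collaborative fixed-time algorithm $\mathcal A$ with $K$ agents and $n$ arms. 1. If $\beta_{\mathcal A}\ge K/\alpha$, then there are a time budget $T$ and an instance $I$ on which the expected number of rounds of $\mathcal A$ is at least $c\,\dfrac{\ln n}{\ln\ln n+\ln\alpha}$. 2. More strongly, only a comparison with one centralized algorithm at one time budget is needed. Let $W=\lceil n\,(\ln n)^3\,(\alpha(\ln n)^{10})^2\rceil$ and let $\mathrm{SR}$ be the Successive Rejects algorithm of Audibert, Bubeck and Munos: with $\overline{\log}(n)=\frac12+\sum_{i=2}^n\frac1i$, $n_0=0$ and $n_k=\max\bigl(0,\bigl\lceil\frac{T-n}{\overline{\log}(n)\,(n+1-k)}\bigr\rceil\bigr)$,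 in each phase $k=1,\dots,n-1$ it pulls every remaining arm $n_k-n_{k-1}$ times and then rejects the remaining arm with the smallest empirical mean (ties broken by the index; all means count as $0$ when $n_k=0$); it outputs the last remaining arm. If $(\mathcal A,T')\succcurlyeq(\mathrm{SR},W)$ for some $T'\in\mathbb N$ with $\frac K\alpha\,T'\le W$, then there is an instance $I$ on which the expected number of rounds of $\mathcal A$ with time budget $T'$ is at least $c\,\dfrac{\ln n}{\ln\ln n+\ln\alpha}$. -/

import Mathlib

open MeasureTheory
open scoped ENNReal

noncomputable section

namespace BestArm

/-! ### Input instances -/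

/-- An input of the best arm identification problem with `n` arms: a reward distribution on `[0,1]`
for every arm, together with the (unique) arm `best` of largest mean. -/
structure Instance (n : ℕ) where
  /-- the reward distribution of each arm -/
  arm : Fin n → Measure unitInterval
  isProb : ∀ i, IsProbabilityMeasure (arm i)
  /-- the arm with the largest mean -/
  best : Fin n
  isBest : ∀ i, i ≠ best → ∫ x, (x : ℝ) ∂(arm i) < ∫ x, (x : ℝ) ∂(arm best)

attribute [instance] Instance.isProb

/-! ### Centralized algorithms: one agent, fully adaptive -/

/-- A randomized centralized fixed-time algorithm. Given the time budget `T`, it makes pulls at the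
times `0, …, T - 1` and then outputs an arm. The next pull and the output are functions of `T`,
of the random seed and of the outcomes observed so far (the outcome of the pull at time `t` is
entry `t` of the observation sequence, entries in the future are `0`; the indices of the previous
pulls can be recomputed from the same data). Budget that is not needed is spent on
pulls that are ignored. -/
structure CentralizedAlg (n : ℕ) where
  /-- the randomness of the algorithm -/
  Seed : Type
  mSeed : MeasurableSpace Seed
  law : Measure Seed
  isProb : IsProbabilityMeasure law
  /-- `pull T t ω h`: the arm pulled at time `t` -/
  pull : (T t : ℕ) → Seed → (ℕ → unitInterval) → Fin n
  /-- `output T ω h`: the answer -/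
  output : (T : ℕ) → Seed → (ℕ → unitInterval) → Fin n
  measurable_pull : ∀ T t, Measurable fun p : Seed × (ℕ → unitInterval) => pull T t p.1 p.2
  measurable_output : ∀ T, Measurable fun p : Seed × (ℕ → unitInterval) => output T p.1 p.2

attribute [instance] CentralizedAlg.mSeed CentralizedAlg.isProb

namespace CentralizedAlg

variable {n : ℕ}

/-- Run the first `t` steps. `X (i, s)` is the reward of the pull number `s` (from `0`) of arm `i`.
The state consists of the outcomes in order of time and of the number of pulls of each arm. -/
def run (O : CentralizedAlg n) (T : ℕ) (ω : O.Seed) (X : Fin n × ℕ → unitInterval) :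
    ℕ → (ℕ → unitInterval) × (Fin n → ℕ)
  | 0 => (fun _ => 0, fun _ => 0)
  | t + 1 =>
    let h := (run O T ω X t).1
    let cnt := (run O T ω X t).2
    let a := O.pull T t ω h
    (Function.update h t (X (a, cnt a)), Function.update cnt a (cnt a + 1))

/-- The probability that the centralized algorithm `O` with time budget `T` errs on `I`;
all rewards are independent, those of arm `i` have law `I.arm i`. -/
def error (O : CentralizedAlg n) (I : Instance n) (T : ℕ) : ℝ≥0∞ :=
  (O.law.prod (Measure.infinitePi fun p : Fin n × ℕ => I.arm p.1))
    {p | O.output T p.1 (O.run T p.1 p.2 T).1 ≠ I.best}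

end CentralizedAlg

/-! ### Non-adaptive collaborative algorithms -/

/-- What has been observed in the previous rounds: `H r k t` is the outcome of pull number `t` of
agent `k` in round `r` (and `0` where there is no such pull). -/
abbrev History (K : ℕ) : Type := ℕ → Fin K → ℕ → unitInterval

/-- The rules of a randomized non-adaptive algorithm for `K` agents and `n` arms.
In each communication step every agent broadcasts everything it knows (message sizes are not
restricted), so at the beginning of round `r` every agent knows the outcomes of all previous rounds.
The first argument of all rules is the time budget, the second one the number of the
round (from `0`), the third one the agent. The random seed is shared by the agents; private
randomness is the case of a seed with independent components. -/
structure Protocol (K n : ℕ) where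
  /-- the randomness of the algorithm -/
  Seed : Type
  mSeed : MeasurableSpace Seed
  law : Measure Seed
  isProb : IsProbabilityMeasure law
  /-- `plan T r k ω H`: the ordered list of arms which agent `k` pulls in round `r`. It is fixed at
  the beginning of the round. -/
  plan : (T r : ℕ) → Fin K → Seed → History K → List (Fin n)
  /-- `answer T r k ω H y`: after its pulls in round `r`, whose outcomes are `y`, agent `k` either
  terminates with an output (`some a`) or requests a communication step (`none`). -/
  answer : (T r : ℕ) → Fin K → Seed → History K → (ℕ → unitInterval) → Option (Fin n)
  measurable_plan : ∀ T r k l, MeasurableSet {p : Seed × History K | plan T r k p.1 p.2 = l}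
  measurable_answer : ∀ T r k a,
    MeasurableSet {p : Seed × History K × (ℕ → unitInterval) | answer T r k p.1 p.2.1 p.2.2 = a}

attribute [instance] Protocol.mSeed Protocol.isProb

namespace Protocol

variable {K n : ℕ}

/-- The rewards: `X (r, k, t, i)` is the reward that pull number `t` of agent `k` in round `r`
yields if it is a pull of arm `i`. -/
abbrev Rewards (K n : ℕ) : Type := ℕ × Fin K × ℕ × Fin n → unitInterval

/-- Run the first `r` rounds. The state consists of the outcomes so far and of the outputs of the
agents that have terminated. An agent that has terminated takes no further action. -/
def run (A : Protocol K n) (T : ℕ) (ω : A.Seed) (X : Rewards K n) :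
    ℕ → History K × (Fin K → Option (Fin n))
  | 0 => (fun _ _ _ => 0, fun _ => none)
  | r + 1 =>
    let H := (run A T ω X r).1
    let out := (run A T ω X r).2
    let y : Fin K → ℕ → unitInterval := fun k t =>
      match out k, (A.plan T r k ω H)[t]? with
      | none, some i => X (r, k, t, i)
      | _, _ => 0
    (Function.update H r y, fun k =>
      match out k with
      | some a => some a
      | none => A.answer T r k ω H (y k))

/-- The number of pulls that agent `k` makes in round `r`. -/
def numPulls (A : Protocol K n) (T : ℕ) (ω : A.Seed) (X : Rewards K n) (r : ℕ) (k : Fin K) : ℕ :=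
  match (A.run T ω X r).2 k with
  | none => (A.plan T r k ω (A.run T ω X r).1).length
  | some _ => 0

/-- The running time of the first `R` rounds: the sum over the rounds of the maximum number of pulls
made by an agent in the round. -/
def time (A : Protocol K n) (T : ℕ) (ω : A.Seed) (X : Rewards K n) (R : ℕ) : ℕ :=
  ∑ r ∈ Finset.range R, Finset.univ.sup (A.numPulls T ω X r)

/-- The number of rounds until all agents have terminated, that is, the number of communication
steps plus one (`∞` if some agent never terminates). -/
def numRounds (A : Protocol K n) (T : ℕ) (ω : A.Seed) (X : Rewards K n) : ℝ≥0∞ :=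
  ⨅ r ∈ {r : ℕ | ∀ k, (A.run T ω X r).2 k ≠ none}, (r : ℝ≥0∞)

/-- The joint law of the random seed and of the rewards on the instance `I`. -/
def measure (A : Protocol K n) (I : Instance n) : Measure (A.Seed × Rewards K n) :=
  A.law.prod (Measure.infinitePi fun p : ℕ × Fin K × ℕ × Fin n => I.arm p.2.2.2)

/-- The probability that the algorithm with time budget `T` errs on `I`, that is, that not all agents
terminate with the best arm as their output. -/
def error (A : Protocol K n) (I : Instance n) (T : ℕ) : ℝ≥0∞ :=
  A.measure I {p | ¬ ∀ k, ∃ r, (A.run T p.1 p.2 r).2 k = some I.best}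

/-- The expected number of rounds on `I` with time budget `T`. -/
def expectedRounds (A : Protocol K n) (I : Instance n) (T : ℕ) : ℝ≥0∞ :=
  ∫⁻ p, A.numRounds T p.1 p.2 ∂(A.measure I)

end Protocol

/-- A randomized non-adaptive fixed-time algorithm for `K` agents and `n` arms: a protocol that
respects every time budget `T`. -/
structure NonAdaptiveAlg (K n : ℕ) extends Protocol K n where
  time_le : ∀ T ω X R, toProtocol.time T ω X R ≤ T

/-! ### Speedup -/

/-- `(A, T')` dominates `(O, T)`. -/
def Dominates {K n : ℕ} (A : NonAdaptiveAlg K n) (T' : ℕ) (O : CentralizedAlg n) (T : ℕ) : Prop :=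
  ∀ I : Instance n, A.error I T' ≤ O.error I T

/-- The speedup of the collaborative algorithm `A` (a supremum over the empty set is `0`). -/
def speedup {K n : ℕ} (A : NonAdaptiveAlg K n) : ℝ≥0∞ :=
  ⨅ (T : ℕ) (_ : 0 < T) (O : CentralizedAlg n) ,
    ⨆ (T' : ℕ) (_ : Dominates A T' O T), (T : ℝ≥0∞) / (T' : ℝ≥0∞)

/-! ### The Successive Rejects algorithm of Audibert, Bubeck and Munos -/

namespace SR

/-- `1/2 + ∑_{i=2}^n 1/i`. -/
def logBar (n : ℕ) : ℝ := 1 / 2 + ∑ i ∈ Finset.Icc 2 n, (1 : ℝ) / i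

/-- The number of pulls that each arm which survives the first `k` phases has received in them. -/
def cum (n T k : ℕ) : ℕ :=
  if k = 0 then 0 else ⌈((T : ℝ) - n) / (logBar n * ((n : ℝ) + 1 - k))⌉₊

/-- The number of pulls in phase `k` (from `0`) of each arm that is active in it. -/
def reps (n T k : ℕ) : ℕ := cum n T (k + 1) - cum n T k

/-- The time at which phase `k` starts; `n - k` arms are active in phase `k`. -/
def start (n T k : ℕ) : ℕ := ∑ j ∈ Finset.range k, (n - j) * reps n T j

/-- The state after `k` phases, given the outcomes `h` in order of time: the list of the
active arms and the sum of the outcomes of each active arm. In phase `k` the arm at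
position `p` of the list is pulled at the times `start n T k + p * reps n T k + u`,
`u < reps n T k`; then the active arm with the smallest empirical mean (equivalently, sum, as all
active arms have been pulled equally often; ties are broken by the index) is rejected. -/
def state (n T : ℕ) (h : ℕ → unitInterval) : ℕ → List (Fin n) × (Fin n → ℝ)
  | 0 => (List.finRange n, fun _ => 0)
  | k + 1 =>
    let l := (state n T h k).1
    let sum : Fin n → ℝ := fun i => (state n T h k).2 i +
      ∑ u ∈ Finset.range (reps n T k),
        (h (start n T k + l.idxOf i * reps n T k + u) : ℝ)
    (open Classical in
      l.filter fun i => ∃ j ∈ l, sum j < sum i ∨ (sum j = sum i ∧ j < i), sum)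

/-- The phase to which time `t` belongs. -/
def phase (n T t : ℕ) : ℕ := ((Finset.range (n - 1)).filter fun k => start n T (k + 1) ≤ t).card

theorem measurable_state (n T k : ℕ) :
    (∀ l, MeasurableSet {h : ℕ → unitInterval | (state n T h k).1 = l}) ∧
      ∀ i, Measurable fun h : ℕ → unitInterval => (state n T h k).2 i := by
  classical
  induction k with
  | zero => exact ⟨fun l => by simp [state], fun i => by simp [state]⟩
  | succ k ih =>
    obtain ⟨ih1, ih2⟩ := ih
    let _ : MeasurableSpace (List (Fin n)) := ⊤
    have _ : DiscreteMeasurableSpace (List (Fin n)) := ⟨fun _ => trivial⟩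
    have hl : Measurable fun h : ℕ → unitInterval => (state n T h k).1 :=
      measurable_to_countable' ih1
    have hs : ∀ i, Measurable fun h : ℕ → unitInterval => (state n T h (k + 1)).2 i := by
      intro i
      have h2 : Measurable fun q : List (Fin n) × (ℕ → unitInterval) =>
          ∑ u ∈ Finset.range (reps n T k),
            (q.2 (start n T k + q.1.idxOf i * reps n T k + u) : ℝ) := by
        refine measurable_from_prod_countable_right fun l => ?_
        exact Finset.measurable_sum _ fun u _ =>
          measurable_subtype_coe.comp (measurable_pi_apply (start n T k + l.idxOf i * reps n T k + u))
      exact (ih2 i).add (h2.comp (hl.prodMk measurable_id))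
    refine ⟨fun l => ?_, hs⟩
    have h3 : Measurable fun q : List (Fin n) × (Fin n → ℝ) =>
        q.1.filter fun i => ∃ j ∈ q.1, q.2 j < q.2 i ∨ (q.2 j = q.2 i ∧ j < i) := by
      refine measurable_from_prod_countable_right fun l' => ?_
      refine measurable_to_countable' fun m => ?_
      have hp : Measurable fun f : Fin n → ℝ => fun i : Fin n =>
          (decide (∃ j ∈ l', f j < f i ∨ (f j = f i ∧ j < i)) : Bool) := by
        refine measurable_pi_lambda _ fun i => measurable_to_bool ?_
        have he : ((fun f : Fin n → ℝ =>
            (decide (∃ j ∈ l', f j < f i ∨ (f j = f i ∧ j < i)) : Bool)) ⁻¹' {true}) =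
            ⋃ j ∈ {j | j ∈ l'}, ({f : Fin n → ℝ | f j < f i} ∪
              ({f : Fin n → ℝ | f j = f i} ∩ {_f | j < i})) := by
          ext f; simp
        rw [he]
        refine MeasurableSet.biUnion (Set.to_countable _) fun j _ => ?_
        exact (measurableSet_lt (measurable_pi_apply j) (measurable_pi_apply i)).union
          ((measurableSet_eq_fun (measurable_pi_apply j) (measurable_pi_apply i)).inter
            (MeasurableSet.const _))
      exact (hp (MeasurableSet.of_discrete (s := {b | l'.filter b = m})))
    have h4 := h3.comp (hl.prodMk (measurable_pi_lambda _ hs))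
    have h5 := h4 (measurableSet_singleton l)
    convert h5 using 1
    ext h
    simp [state]

end SR

/-- The (deterministic) Successive Rejects algorithm for `n ≥ 1` arms. -/
def successiveRejects (n : ℕ) (hn : 0 < n) : CentralizedAlg n where
  Seed := Unit
  mSeed := inferInstance
  law := Measure.dirac ()
  isProb := inferInstance
  pull T t _ h :=
    let k := SR.phase n T t
    (SR.state n T h k).1.getD ((t - SR.start n T k) / SR.reps n T k) ⟨0, hn⟩
  output T _ h := (SR.state n T h (n - 1)).1.headD ⟨0, hn⟩
  measurable_pull T t := by
    let _ : MeasurableSpace (List (Fin n)) := ⊤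
    have _ : DiscreteMeasurableSpace (List (Fin n)) := ⟨fun _ => trivial⟩
    have hl : Measurable fun h : ℕ → unitInterval => (SR.state n T h (SR.phase n T t)).1 :=
      measurable_to_countable' (SR.measurable_state n T _).1
    exact (Measurable.of_discrete (f := fun l : List (Fin n) =>
      l.getD ((t - SR.start n T (SR.phase n T t)) / SR.reps n T (SR.phase n T t)) ⟨0, hn⟩)).comp
      (hl.comp measurable_snd)
  measurable_output T := by
    let _ : MeasurableSpace (List (Fin n)) := ⊤
    have _ : DiscreteMeasurableSpace (List (Fin n)) := ⟨fun _ => trivial⟩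
    have hl : Measurable fun h : ℕ → unitInterval => (SR.state n T h (n - 1)).1 :=
      measurable_to_countable' (SR.measurable_state n T _).1
    exact (Measurable.of_discrete (f := fun l : List (Fin n) => l.headD ⟨0, hn⟩)).comp
      (hl.comp measurable_snd)

/-- The time `n ln³ n (α ln¹⁰ n)²` (rounded up). -/
def benchmarkTime (n : ℕ) (α : ℝ) : ℕ :=
  ⌈(n : ℝ) * Real.log n ^ 3 * (α * Real.log n ^ 10) ^ 2⌉₊

end BestArm

end

noncomputable section

namespace BestArm

/-! ### Product measures -/

/-! On the hard instances the best arm `b` always yields `1`, and any other arm yields `0` ("fails")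
with probability `y ^ l`, where `l` is its level and `y = 1 / (4τ)`, `τ = (α ln n)^25`. The levels
are independent and geometric with ratio `y`, truncated at `R`, so that about `n y ^ j` arms have
level at least `j`.

Upper bound on success. Only a failure distinguishes an arm of level `r` from a perfect one. Let
round `r` have the threshold `(4τ)^r τ`. While `b` respects the thresholds before round `r`, it is
pulled at most `(4τ)^r / 2` times, so giving it level `r` changes the probability of what happens by
a factor of at most 2 (`failLaw_update_zero_le`). Giving `b` level `r` amounts to conditioning the
random levels on an event of probability at least `y ^ r / 2` (`mul_lintegral_update_le`). After
both changes of measure the instance no longer singles out `b`, and the sum over `b` can be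
estimated on one fixed instance (`sum_lintegral_failLaw_le`). There a round has at most `K T` pulls
in total, and by non-adaptivity their arms are fixed before the round, so the expected number of
arms that exceed the threshold in round `r` is at most `K T / ((4τ)^r τ)`; and one agent outputs at
most one arm. The powers of `4τ` cancel in each round, and the probabilities of being correct within
`R` rounds, summed over `b`, are at most `4 (4τ)^R + 4 R K T / τ` (`sum_lintegral_output_le`,
`le_time_of_output`). For `R` about `ln n / (52 (ln ln n + ln α))` this is at most `n / 4`.

Lower bound on success. Successive Rejects errs with probability at most `1 / n` when no level is
overpopulated (`error_successiveRejects_balanced_le`), and the levels have this property with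
probability at least 3/4. An algorithm that dominates it and has few expected rounds is, by Markov's
inequality, correct within `R` rounds with probability at least 1/2 on all these instances, so the
same sum is at least `3 n / 8`: a contradiction. A speedup of `K / α` yields such a domination
(`exists_dominates_of_le_speedup`). -/

theorem measurable_update_pair {ι : Type*} [DecidableEq ι] {X : ι → Type*}
    [∀ i, MeasurableSpace (X i)] (i : ι) :
    Measurable fun p : X i × (∀ j, X j) => Function.update p.2 i p.1 := by
  refine measurable_pi_lambda _ fun j => ?_
  by_cases h : j = i
  · subst h; simpa using measurable_fst
  · simp only [Function.update_of_ne h]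
    exact (measurable_pi_apply j).comp measurable_snd

/-- Resampling one coordinate does not change a product measure. -/
theorem map_update_infinitePi {ι : Type*} [DecidableEq ι] {X : ι → Type*}
    [∀ i, MeasurableSpace (X i)] (μ : ∀ i, Measure (X i)) [∀ i, IsProbabilityMeasure (μ i)] (i : ι) :
    ((μ i).prod (Measure.infinitePi μ)).map (fun p => Function.update p.2 i p.1) =
      Measure.infinitePi μ := by
  have hm := measurable_update_pair (X := X) i
  refine Measure.eq_infinitePi _ fun s t ht => ?_
  rw [Measure.map_apply hm (.pi s.countable_toSet fun _ _ => ht _)]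
  by_cases hi : i ∈ s
  · have : (fun p : X i × (∀ j, X j) => Function.update p.2 i p.1) ⁻¹' (s : Set ι).pi t =
        t i ×ˢ ((s.erase i : Finset ι) : Set ι).pi t := by
      ext p
      simp only [Set.mem_preimage, Set.mem_pi, Finset.mem_coe, Set.mem_prod, Finset.mem_erase]
      constructor
      · intro h
        refine ⟨by simpa using h i hi, fun j hj => ?_⟩
        simpa [Function.update_of_ne hj.1] using h j hj.2
      · rintro ⟨h1, h2⟩ j hj
        by_cases h : j = i
        · subst h; simpa using h1
        · simpa [Function.update_of_ne h] using h2 j ⟨h, hj⟩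
    rw [this, Measure.prod_prod, Measure.infinitePi_pi _ (fun j _ => ht j),
      Finset.mul_prod_erase s (fun j => μ j (t j)) hi]
  · have : (fun p : X i × (∀ j, X j) => Function.update p.2 i p.1) ⁻¹' (s : Set ι).pi t =
        Set.univ ×ˢ (s : Set ι).pi t := by
      ext p
      simp only [Set.mem_preimage, Set.mem_pi, Finset.mem_coe, Set.mem_prod, Set.mem_univ, true_and]
      refine forall₂_congr fun j hj => ?_
      rw [Function.update_of_ne (ne_of_mem_of_not_mem hj hi)]
    rw [this, Measure.prod_prod, Measure.infinitePi_pi _ (fun j _ => ht j), measure_univ, one_mul]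

/-- A set that does not depend on the coordinate `i` is independent of this coordinate. -/
theorem infinitePi_inter_coord {ι : Type*} [DecidableEq ι] {X : ι → Type*}
    [∀ i, MeasurableSpace (X i)] (μ : ∀ i, Measure (X i)) [∀ i, IsProbabilityMeasure (μ i)] (i : ι)
    {S : Set (∀ j, X j)} (hS : MeasurableSet S) (hSi : ∀ x y, Function.update x i y ∈ S ↔ x ∈ S)
    {A : Set (X i)} (hA : MeasurableSet A) :
    Measure.infinitePi μ (S ∩ {x | x i ∈ A}) = μ i A * Measure.infinitePi μ S := by
  have hm := measurable_update_pair (X := X) i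
  conv_lhs => rw [← map_update_infinitePi μ i]
  have hA' : MeasurableSet {x : ∀ j, X j | x i ∈ A} := measurable_pi_apply i hA
  rw [Measure.map_apply hm (hS.inter hA'), ← Measure.prod_prod]
  congr 1
  ext p
  simp [hSi, and_comm]

/-! ### Reward distributions -/

/-- The distribution of a reward that is `0` with probability `q` and `1` otherwise. -/
def rewardLaw (q : unitInterval) : Measure unitInterval :=
  ENNReal.ofReal (1 - q) • Measure.dirac 1 + ENNReal.ofReal q • Measure.dirac 0

instance (q : unitInterval) : IsProbabilityMeasure (rewardLaw q) := by
  constructor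
  have h1 : (0 : ℝ) ≤ 1 - q := by linarith [q.2.2]
  simp only [rewardLaw, Measure.coe_add, Measure.coe_smul, Pi.add_apply, Pi.smul_apply,
    measure_univ, smul_eq_mul, mul_one]
  rw [← ENNReal.ofReal_add h1 q.2.1]
  simp

theorem integral_rewardLaw (q : unitInterval) : ∫ x, (x : ℝ) ∂(rewardLaw q) = 1 - q := by
  have h1 : (0 : ℝ) ≤ 1 - q := by linarith [q.2.2]
  have hi : ∀ (a : ℝ) (z : unitInterval),
      Integrable (fun x : unitInterval => (x : ℝ)) (ENNReal.ofReal a • Measure.dirac z) :=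
    fun a z => (integrable_dirac (by finiteness)).smul_measure (by finiteness)
  rw [rewardLaw, integral_add_measure (hi _ _) (hi _ _), integral_smul_measure,
    integral_smul_measure, integral_dirac, integral_dirac]
  simp [ENNReal.toReal_ofReal h1]

theorem rewardLaw_zero : rewardLaw 0 = Measure.dirac 1 := by
  simp [rewardLaw]

theorem rewardLaw_one_eq (q : unitInterval) : rewardLaw q {1} = ENNReal.ofReal (1 - q) := by
  simp [rewardLaw]

theorem rewardLaw_ne_one (q : unitInterval) : rewardLaw q {x | x ≠ 1} = ENNReal.ofReal q := by
  simp [rewardLaw]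

/-! ### Replacing rewards by ones -/

/-- Replace the coordinates in `B` by `1`. -/
def fillOnes {ι : Type*} (B : Set ι) [DecidablePred (· ∈ B)] (X : ι → unitInterval) :
    ι → unitInterval := fun i => if i ∈ B then 1 else X i

/-- If an event `E` depends on the coordinates in `B` only through adaptively revealed ones, of which
there are at most `s`, and each of these is not `1` with probability at most `ε`, then the event
becomes more likely by at most the factor `1 / (1 - s ε)` if these coordinates are made constantly
`1`. -/
theorem infinitePi_fillOnes_le {ι : Type*} [Countable ι] [DecidableEq ι] (B : Set ι)
    [DecidablePred (· ∈ B)] (q q' : ι → unitInterval) (hq' : ∀ i, q' i = if i ∈ B then 0 else q i)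
    (ε s : ℝ≥0∞) (hε : ∀ i ∈ B, ENNReal.ofReal (q i) ≤ ε)
    {E : Set (ι → unitInterval)} (hE : MeasurableSet E)
    (Q : ι → Set (ι → unitInterval)) (hQ : ∀ i, MeasurableSet (Q i))
    (hs : ∀ X ∈ E, ∑' i, (B ∩ {i | X ∈ Q i}).indicator (fun _ => (1 : ℝ≥0∞)) i ≤ s)
    (hdep : ∀ X X', X ∈ E → (∀ i ∈ B, X i = 1) → (∀ i ∈ B, X ∈ Q i → X' i = 1) →
      (∀ i ∉ B, X' i = X i) → X' ∈ E) :
    Measure.infinitePi (fun i => rewardLaw (q' i)) E ≤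
      Measure.infinitePi (fun i => rewardLaw (q i)) E +
        ε * s * Measure.infinitePi (fun i => rewardLaw (q' i)) E := by
  set μ := Measure.infinitePi (fun i => rewardLaw (q i)) with hμ
  set μ' := Measure.infinitePi (fun i => rewardLaw (q' i)) with hμ'
  have hf : ∀ i, Measurable fun x : unitInterval => if i ∈ B then (1 : unitInterval) else x := by
    intro i
    split_ifs
    · exact measurable_const
    · exact measurable_id
  have hΦ : Measurable (fillOnes B) :=
    measurable_pi_lambda _ fun i => (hf i).comp (measurable_pi_apply i)
  have hmap : μ.map (fillOnes B) = μ' := by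
    have := Measure.infinitePi_map_pi (fun i => rewardLaw (q i)) hf
    rw [hμ, hμ']
    refine Eq.trans this ?_
    congr 1
    funext i
    by_cases hi : i ∈ B
    · simp [hi, hq', rewardLaw_zero]
    · simp [hi, hq']
  have happ : ∀ S, MeasurableSet S → μ' S = μ (fillOnes B ⁻¹' S) := fun S hS => by
    rw [← hmap, Measure.map_apply hΦ hS]
  -- Coupling of the two laws on one sample `X`: if the filled sample lies in `E`, then either all
  -- revealed coordinates were `1` anyway and `X` itself lies in `E`, or some revealed coordinate of
  -- `X` fails.
  have hsub : fillOnes B ⁻¹' E ⊆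
      E ∪ ⋃ i, ⋃ (_ : i ∈ B), (fillOnes B ⁻¹' (E ∩ Q i)) ∩ {X | X i ∈ {x | x ≠ 1}} := by
    intro X hX
    by_cases h : ∀ i ∈ B, fillOnes B X ∈ Q i → X i = 1
    · refine Or.inl (hdep (fillOnes B X) X hX ?_ h ?_)
      · intro i hi; simp [fillOnes, hi]
      · intro i hi; simp [fillOnes, hi]
    · push Not at h
      obtain ⟨i, hi, hiQ, hi1⟩ := h
      exact Or.inr (Set.mem_iUnion₂.2 ⟨i, hi, ⟨hX, hiQ⟩, hi1⟩)
  -- Whether `i` is revealed is read off the filled sample, which ignores coordinate `i`; hence this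
  -- event is independent of a failure there.
  have hone : ∀ i ∈ B, μ ((fillOnes B ⁻¹' (E ∩ Q i)) ∩ {X | X i ∈ {x | x ≠ 1}}) ≤
      ε * μ' (E ∩ Q i) := by
    intro i hi
    rw [hμ, infinitePi_inter_coord _ i (hΦ (hE.inter (hQ i))) _ (by measurability),
      rewardLaw_ne_one, ← hμ, happ _ (hE.inter (hQ i))]
    · gcongr
      exact hε i hi
    · intro X y
      have : fillOnes B (Function.update X i y) = fillOnes B X := by
        funext j
        by_cases hj : j ∈ B
        · simp [fillOnes, hj]
        · have : j ≠ i := fun h => hj (h ▸ hi)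
          simp [fillOnes, hj, Function.update_of_ne this]
      simp only [Set.mem_preimage, this]
  have hind : ∀ i X, (B ∩ {i | X ∈ Q i}).indicator (fun _ => (1 : ℝ≥0∞)) i =
      if i ∈ B then (Q i).indicator (fun _ => (1 : ℝ≥0∞)) X else 0 := by
    intro i X
    by_cases h1 : i ∈ B <;> by_cases h2 : X ∈ Q i <;> simp [h1, h2]
  calc μ' E = μ (fillOnes B ⁻¹' E) := happ E hE
    _ ≤ μ E + ∑' i, μ (⋃ (_ : i ∈ B), (fillOnes B ⁻¹' (E ∩ Q i)) ∩ {X | X i ∈ {x | x ≠ 1}}) :=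
        (measure_mono hsub).trans ((measure_union_le _ _).trans
          (add_le_add le_rfl (measure_iUnion_le _)))
    _ ≤ μ E + ∑' i, ε * ∫⁻ X in E, (B ∩ {i | X ∈ Q i}).indicator (fun _ => (1 : ℝ≥0∞)) i ∂μ' := by
        gcongr with i
        by_cases hi : i ∈ B
        · simp only [hi, Set.iUnion_true]
          refine (hone i hi).trans ?_
          gcongr
          simp only [hind, hi, if_true]
          rw [lintegral_indicator_const (hQ i), one_mul, Measure.restrict_apply (hQ i),
            Set.inter_comm]
        · simp [hi]
    _ = μ E + ε * ∫⁻ X in E, ∑' i, (B ∩ {i | X ∈ Q i}).indicator (fun _ => (1 : ℝ≥0∞)) i ∂μ' := by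
        rw [ENNReal.tsum_mul_left, lintegral_tsum]
        intro i
        simp only [hind]
        split_ifs
        · exact (measurable_const.indicator (hQ i)).aemeasurable
        · exact measurable_const.aemeasurable
    _ ≤ μ E + ε * ∫⁻ _ in E, s ∂μ' := by
        gcongr 2
        exact setLIntegral_mono measurable_const hs
    _ = μ E + ε * s * μ' E := by
        rw [setLIntegral_const, mul_assoc]

/-! ### Runs of a collaborative protocol and their pull counts. -/

namespace Protocol

variable {K n : ℕ}

/-- In the run on the rewards `X`, pull number `p.2.2.1` of agent `p.2.1` in round `p.1` is made and
is a pull of arm `p.2.2.2`. -/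
def Pulled (A : Protocol K n) (T : ℕ) (ω : A.Seed) (X : Rewards K n)
    (p : ℕ × Fin K × ℕ × Fin n) : Prop :=
  (A.run T ω X p.1).2 p.2.1 = none ∧
    (A.plan T p.1 p.2.1 ω (A.run T ω X p.1).1)[p.2.2.1]? = some p.2.2.2

open Classical in
/-- The number of pulls of arm `i` in round `r`. -/
def pulls (A : Protocol K n) (T : ℕ) (ω : A.Seed) (X : Rewards K n) (r : ℕ) (i : Fin n) : ℝ≥0∞ :=
  ∑ k, ∑' t, if A.Pulled T ω X (r, k, t, i) then 1 else 0

/-- The outcomes of round `r`. -/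
def outcomes (A : Protocol K n) (T : ℕ) (ω : A.Seed) (X : Rewards K n) (r : ℕ) (k : Fin K) (t : ℕ) :
    unitInterval :=
  match (A.run T ω X r).2 k, (A.plan T r k ω (A.run T ω X r).1)[t]? with
  | none, some i => X (r, k, t, i)
  | _, _ => 0

theorem run_succ_fst (A : Protocol K n) (T : ℕ) (ω : A.Seed) (X : Rewards K n) (r : ℕ) :
    (A.run T ω X (r + 1)).1 = Function.update (A.run T ω X r).1 r (A.outcomes T ω X r) := rfl

theorem run_succ_snd (A : Protocol K n) (T : ℕ) (ω : A.Seed) (X : Rewards K n) (r : ℕ) (k : Fin K) :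
    (A.run T ω X (r + 1)).2 k = ((A.run T ω X r).2 k).elim
      (A.answer T r k ω (A.run T ω X r).1 (A.outcomes T ω X r k)) some := by
  change (match (A.run T ω X r).2 k with
    | some a => some a
    | none => A.answer T r k ω (A.run T ω X r).1 (A.outcomes T ω X r k)) = _
  cases (A.run T ω X r).2 k <;> rfl

/-- Rewards that are never revealed cannot influence the run; by induction on the rounds it suffices
that the revealed ones agree. -/
theorem run_congr (A : Protocol K n) (T : ℕ) (ω : A.Seed) {X X' : Rewards K n} {R : ℕ}
    (h : ∀ p, p.1 < R → A.Pulled T ω X p → X' p = X p) :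
    ∀ r ≤ R, A.run T ω X' r = A.run T ω X r := by
  intro r
  induction r with
  | zero => intro _; rfl
  | succ r ih =>
    intro hr
    have ih := ih (by omega)
    have hy : A.outcomes T ω X' r = A.outcomes T ω X r := by
      funext k t
      simp only [outcomes, ih]
      split
      · rename_i i h1 h2
        exact h (r, k, t, i) (by simpa using hr) ⟨h1, h2⟩
      · rfl
    refine Prod.ext ?_ (funext fun k => ?_)
    · rw [run_succ_fst, run_succ_fst, hy, ih]
    · rw [run_succ_snd, run_succ_snd, hy, ih]

/-- This is non-adaptivity: the plan of round `r`, and so its pull counts, is determined by the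
state before the round. -/
theorem pulls_congr (A : Protocol K n) (T : ℕ) (ω : A.Seed) {X X' : Rewards K n} {r : ℕ}
    (h : A.run T ω X' r = A.run T ω X r) (i : Fin n) :
    A.pulls T ω X' r i = A.pulls T ω X r i := by
  have hP : ∀ k t, A.Pulled T ω X' (r, k, t, i) ↔ A.Pulled T ω X (r, k, t, i) := fun k t => by
    simp only [Pulled, h]
  classical
  exact Finset.sum_congr rfl fun k _ => tsum_congr fun t => if_congr (hP k t) rfl rfl

theorem run_eq_some_of_le (A : Protocol K n) (T : ℕ) (ω : A.Seed) (X : Rewards K n) {k : Fin K}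
    {a : Fin n} {r r' : ℕ} (hr : r ≤ r') (h : (A.run T ω X r).2 k = some a) :
    (A.run T ω X r').2 k = some a := by
  induction r', hr using Nat.le_induction with
  | base => exact h
  | succ r' _ ih => rw [run_succ_snd, ih]; rfl

theorem sum_pulls_le (A : Protocol K n) (T : ℕ) (ω : A.Seed) (X : Rewards K n) (r : ℕ) :
    ∑ i, A.pulls T ω X r i ≤ ∑ k, (A.numPulls T ω X r k : ℝ≥0∞) := by
  classical
  simp only [pulls]
  rw [Finset.sum_comm]
  refine Finset.sum_le_sum fun k _ => ?_
  rw [← Summable.tsum_finsetSum fun _ _ => ENNReal.summable]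
  have h1 : ∀ t, (∑ i, if A.Pulled T ω X (r, k, t, i) then (1 : ℝ≥0∞) else 0) ≤
      if t ∈ Finset.range (A.numPulls T ω X r k) then 1 else 0 := by
    intro t
    by_cases ht : ∃ i, A.Pulled T ω X (r, k, t, i)
    · obtain ⟨i, hi⟩ := ht
      have hlt : t < A.numPulls T ω X r k := by
        obtain ⟨h1, h2⟩ := hi
        simp only at h1 h2
        obtain ⟨h3, -⟩ := List.getElem?_eq_some_iff.1 h2
        simpa [numPulls, h1] using h3
      rw [if_pos (Finset.mem_range.2 hlt), Finset.sum_eq_single i]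
      · simp [hi]
      · intro j _ hj
        rw [if_neg]
        intro h
        exact hj (Option.some_injective _ (h.2.symm.trans hi.2))
      · simp
    · push Not at ht
      simp [ht]
  refine (ENNReal.tsum_le_tsum h1).trans ?_
  rw [tsum_eq_sum (s := Finset.range (A.numPulls T ω X r k))]
  · rw [Finset.sum_ite_mem]; simp
  · intro t ht; simp only [ht, if_false]

theorem _root_.BestArm.NonAdaptiveAlg.sum_pulls_le_budget (A : NonAdaptiveAlg K n) (T : ℕ)
    (ω : A.Seed) (X : Rewards K n) (r : ℕ) : ∑ i, A.pulls T ω X r i ≤ (K : ℝ≥0∞) * T := by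
  refine (A.toProtocol.sum_pulls_le T ω X r).trans ?_
  have h : ∀ k, A.numPulls T ω X r k ≤ T := fun k =>
    (Finset.le_sup (f := A.numPulls T ω X r) (Finset.mem_univ k)).trans
      ((Finset.single_le_sum (f := fun r => Finset.univ.sup (A.numPulls T ω X r))
        (fun _ _ => Nat.zero_le _) (Finset.self_mem_range_succ r)).trans (A.time_le T ω X (r + 1)))
  refine (Finset.sum_le_sum fun k _ => (Nat.cast_le.2 (h k) : _ ≤ (T : ℝ≥0∞))).trans ?_
  simp

/-! ### Measurability -/

theorem measurable_run (A : Protocol K n) (T r : ℕ) :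
    (Measurable fun p : A.Seed × Rewards K n => (A.run T p.1 p.2 r).1) ∧
      ∀ k o, MeasurableSet {p : A.Seed × Rewards K n | (A.run T p.1 p.2 r).2 k = o} := by
  induction r with
  | zero => exact ⟨measurable_const, fun k o => MeasurableSet.const (none = o)⟩
  | succ r ih =>
    obtain ⟨ih1, ih2⟩ := ih
    let _ : MeasurableSpace (List (Fin n)) := ⊤
    have _ : DiscreteMeasurableSpace (List (Fin n)) := ⟨fun _ => trivial⟩
    let _ : MeasurableSpace (Option (Fin n)) := ⊤
    have _ : DiscreteMeasurableSpace (Option (Fin n)) := ⟨fun _ => trivial⟩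
    have hout : ∀ k, Measurable fun p : A.Seed × Rewards K n => (A.run T p.1 p.2 r).2 k :=
      fun k => measurable_to_countable' (ih2 k)
    have hplan : ∀ k, Measurable fun p : A.Seed × Rewards K n =>
        A.plan T r k p.1 (A.run T p.1 p.2 r).1 := fun k =>
      (measurable_to_countable' (f := fun q : A.Seed × History K => A.plan T r k q.1 q.2)
        (A.measurable_plan T r k)).comp (measurable_fst.prodMk ih1)
    have hy : ∀ k, Measurable fun p : A.Seed × Rewards K n => A.outcomes T p.1 p.2 r k := by
      intro k
      refine measurable_pi_lambda _ fun t => ?_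
      have h2 : Measurable fun q : (Option (Fin n) × List (Fin n)) × Rewards K n =>
          match q.1.1, q.1.2[t]? with
          | none, some i => q.2 (r, k, t, i)
          | _, _ => (0 : unitInterval) := by
        refine measurable_from_prod_countable_right fun l => ?_
        dsimp only
        split
        · exact measurable_pi_apply _
        · exact measurable_const
      exact h2.comp (((hout k).prodMk (hplan k)).prodMk measurable_snd)
    constructor
    · simp only [run_succ_fst]
      refine measurable_pi_lambda _ fun s => ?_
      by_cases hs : s = r
      · subst hs
        simp only [Function.update_self]
        exact measurable_pi_lambda _ hy
      · simp only [Function.update_of_ne hs]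
        exact (measurable_pi_apply s).comp ih1
    · intro k o
      have h3 := (measurable_fst.prodMk (ih1.prodMk (hy k))) (A.measurable_answer T r k o)
      have h4 : {p : A.Seed × Rewards K n | (A.run T p.1 p.2 (r + 1)).2 k = o} =
          ({p | (A.run T p.1 p.2 r).2 k = none} ∩
            {p | A.answer T r k p.1 (A.run T p.1 p.2 r).1 (A.outcomes T p.1 p.2 r k) = o}) ∪
          ({p | (A.run T p.1 p.2 r).2 k = none}ᶜ ∩ {p | (A.run T p.1 p.2 r).2 k = o}) := by
        ext p
        simp only [run_succ_snd, Set.mem_ofPred_eq, Set.mem_union, Set.mem_inter_iff,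
          Set.mem_compl_iff]
        cases (A.run T p.1 p.2 r).2 k <;> simp
      rw [h4]
      exact ((ih2 k none).inter h3).union ((ih2 k none).compl.inter (ih2 k o))

theorem measurableSet_pulled (A : Protocol K n) (T : ℕ) (q : ℕ × Fin K × ℕ × Fin n) :
    MeasurableSet {p : A.Seed × Rewards K n | A.Pulled T p.1 p.2 q} := by
  let _ : MeasurableSpace (List (Fin n)) := ⊤
  have _ : DiscreteMeasurableSpace (List (Fin n)) := ⟨fun _ => trivial⟩
  have hplan : Measurable fun p : A.Seed × Rewards K n =>
      A.plan T q.1 q.2.1 p.1 (A.run T p.1 p.2 q.1).1 :=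
    (measurable_to_countable' (f := fun p : A.Seed × History K => A.plan T q.1 q.2.1 p.1 p.2)
      (A.measurable_plan T q.1 q.2.1)).comp
        (measurable_fst.prodMk (A.measurable_run T q.1).1)
  exact ((A.measurable_run T q.1).2 q.2.1 none).inter
    (hplan (MeasurableSet.of_discrete (s := {l | l[q.2.2.1]? = some q.2.2.2})))

theorem measurable_pulls (A : Protocol K n) (T r : ℕ) (i : Fin n) :
    Measurable fun p : A.Seed × Rewards K n => A.pulls T p.1 p.2 r i := by
  classical
  refine Finset.measurable_sum _ fun k _ => Measurable.tsum fun t => ?_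
  exact Measurable.ite (A.measurableSet_pulled T _) measurable_const measurable_const

/-! ### Making one arm perfect -/

/-- The joint law of the random seed and the rewards if arm `i` fails with probability `q i`. -/
def failLaw (A : Protocol K n) (q : Fin n → unitInterval) : Measure (A.Seed × Rewards K n) :=
  A.law.prod (Measure.infinitePi fun p : ℕ × Fin K × ℕ × Fin n => rewardLaw (q p.2.2.2))

instance (A : Protocol K n) (q : Fin n → unitInterval) : IsProbabilityMeasure (A.failLaw q) := by
  unfold failLaw; infer_instance

/-- An event that depends only on the first `R` rounds, in which arm `b` is pulled too rarely to
observe a failure, is at most twice as likely if arm `b` never fails. -/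
theorem failLaw_update_zero_le (A : Protocol K n) (T R : ℕ) (b : Fin n) (q : Fin n → unitInterval)
    (s : ℝ≥0∞) (hqs : ENNReal.ofReal (q b) * s ≤ 2⁻¹) {E : Set (A.Seed × Rewards K n)}
    (hE : MeasurableSet E) (hs : ∀ p ∈ E, ∑ r ∈ Finset.range R, A.pulls T p.1 p.2 r b ≤ s)
    (hdep : ∀ ω X X', (ω, X) ∈ E → (∀ r ≤ R, A.run T ω X' r = A.run T ω X r) → (ω, X') ∈ E) :
    A.failLaw (Function.update q b 0) E ≤ 2 * A.failLaw q E := by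
  classical
  have key : A.failLaw (Function.update q b 0) E ≤
      A.failLaw q E + ENNReal.ofReal (q b) * s * A.failLaw (Function.update q b 0) E := by
    unfold failLaw
    rw [Measure.prod_apply hE, Measure.prod_apply hE,
      ← lintegral_const_mul _ (measurable_measure_prodMk_left hE),
      ← lintegral_add_left (measurable_measure_prodMk_left hE)]
    refine lintegral_mono fun ω => ?_
    -- For a fixed seed, the filled coordinates are all rewards of arm `b`; those revealed are its
    -- pulls in the rounds before `R`.
    refine infinitePi_fillOnes_le {p : ℕ × Fin K × ℕ × Fin n | p.2.2.2 = b}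
      (fun p => q p.2.2.2) (fun p => Function.update q b 0 p.2.2.2) ?_ (ENNReal.ofReal (q b)) s ?_
      (measurable_prodMk_left hE) (fun p => {X | p.1 < R ∧ A.Pulled T ω X p}) ?_ ?_ ?_
    · intro p
      simp [Function.update_apply]
    · intro p hp
      rw [Set.mem_ofPred_eq] at hp
      rw [hp]
    · intro p
      exact (MeasurableSet.const _).inter (measurable_prodMk_left (A.measurableSet_pulled T p))
    · intro X hX
      refine le_trans (le_of_eq ?_) (hs (ω, X) hX)
      rw [ENNReal.tsum_prod', tsum_eq_sum (s := Finset.range R)]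
      · refine Finset.sum_congr rfl fun r hr => ?_
        rw [ENNReal.tsum_prod', tsum_fintype]
        refine Finset.sum_congr rfl fun k _ => ?_
        rw [ENNReal.tsum_prod']
        refine tsum_congr fun t => ?_
        rw [tsum_fintype, Finset.sum_eq_single b]
        · simp [Set.indicator_apply, Finset.mem_range.1 hr]
        · intro i _ hi
          simp [hi]
        · simp
      · intro r hr
        rw [Finset.mem_range] at hr
        simp [hr]
    · intro X X' hX hB h1 h2
      refine hdep ω X X' hX (A.run_congr T ω fun p hp hpull => ?_)
      by_cases hb : p.2.2.2 = b
      · rw [h1 p hb ⟨hp, hpull⟩, hB p hb]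
      · exact h2 p hb
  -- Since this probability is finite, the half of it on the right can be absorbed into the
  -- left-hand side.
  have hfin : A.failLaw (Function.update q b 0) E ≠ ∞ := measure_ne_top _ _
  have h2 : A.failLaw (Function.update q b 0) E ≤
      A.failLaw q E + 2⁻¹ * A.failLaw (Function.update q b 0) E :=
    key.trans (by gcongr)
  have h3 : 2 * A.failLaw (Function.update q b 0) E ≤
      2 * A.failLaw q E + A.failLaw (Function.update q b 0) E := by
    calc _ ≤ 2 * (A.failLaw q E + 2⁻¹ * A.failLaw (Function.update q b 0) E) := by gcongr
      _ = _ := by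
        rw [mul_add, ← mul_assoc, ENNReal.mul_inv_cancel (by simp) (by simp), one_mul]
  rw [two_mul] at h3
  exact (ENNReal.add_le_add_iff_right hfin).1 h3

end Protocol

/-! ### A random instance with independent levels -/

/-- The law of independent levels of the arms. -/
def levelLaw (n : ℕ) (ρ : Measure ℕ) : Measure (Fin n → ℕ) := Measure.infinitePi fun _ => ρ

instance (n : ℕ) (ρ : Measure ℕ) [IsProbabilityMeasure ρ] : IsProbabilityMeasure (levelLaw n ρ) := by
  unfold levelLaw; infer_instance

/-- Resampling the level of `b` preserves the law; keeping only the outcome `r` of the resampling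
loses a nonnegative part. This is the price of pretending that `b` has level `r`. -/
theorem mul_lintegral_update_le {n : ℕ} (ρ : Measure ℕ) [IsProbabilityMeasure ρ] (b : Fin n) (r : ℕ)
    (F : (Fin n → ℕ) → ℝ≥0∞) :
    ρ {r} * ∫⁻ l, F (Function.update l b r) ∂(levelLaw n ρ) ≤ ∫⁻ l, F l ∂(levelLaw n ρ) := by
  have hm := measurable_update_pair (X := fun _ : Fin n => ℕ) b
  have hF : Measurable F := Measurable.of_discrete
  have h := map_update_infinitePi (fun _ : Fin n => ρ) b
  conv_rhs => rw [levelLaw, ← h]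
  have hFm : Measurable fun p : ℕ × (Fin n → ℕ) => F (Function.update p.2 b p.1) := hF.comp hm
  rw [lintegral_map hF hm, lintegral_prod _ hFm.aemeasurable, mul_comm,
    ← lintegral_singleton (fun y => ∫⁻ l, F (Function.update l b y) ∂(levelLaw n ρ))]
  exact setLIntegral_le_lintegral _ _

namespace Protocol

variable {K n : ℕ}

/-- Making the perfect arm `b` an arm of level `r` costs a factor 2, and making this level a random
one costs `1 / ρ {r}`. Then all `b` share the instance `f ∘ l`, so a bound on the sum of the
probabilities there suffices. -/
theorem sum_lintegral_failLaw_le (A : Protocol K n) (T r : ℕ) (ρ : Measure ℕ)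
    [IsProbabilityMeasure ρ] (hρ : ρ {r} ≠ 0) (f : ℕ → unitInterval) (s c : ℝ≥0∞)
    (hfs : ENNReal.ofReal (f r) * s ≤ 2⁻¹) (E : Fin n → Set (A.Seed × Rewards K n))
    (hE : ∀ b, MeasurableSet (E b))
    (hs : ∀ b, ∀ p ∈ E b, ∑ r' ∈ Finset.range r, A.pulls T p.1 p.2 r' b ≤ s)
    (hdep : ∀ b ω X X', (ω, X) ∈ E b → (∀ r' ≤ r, A.run T ω X' r' = A.run T ω X r') → (ω, X') ∈ E b)
    (hc : ∀ l : Fin n → ℕ, ∑ b, A.failLaw (f ∘ l) (E b) ≤ c) :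
    ∑ b, ∫⁻ l, A.failLaw (Function.update (f ∘ l) b 0) (E b) ∂(levelLaw n ρ) ≤
      2 * (ρ {r})⁻¹ * c := by
  have h1 : ∀ b, ∫⁻ l, A.failLaw (Function.update (f ∘ l) b 0) (E b) ∂(levelLaw n ρ) ≤
      2 * (ρ {r})⁻¹ * ∫⁻ l, A.failLaw (f ∘ l) (E b) ∂(levelLaw n ρ) := by
    intro b
    have h2 : ∀ l : Fin n → ℕ, A.failLaw (Function.update (f ∘ l) b 0) (E b) ≤
        2 * A.failLaw (f ∘ Function.update l b r) (E b) := by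
      intro l
      have h3 : Function.update (f ∘ l) b 0 =
          Function.update (f ∘ Function.update l b r) b 0 := by
        rw [Function.comp_update, Function.update_idem]
      rw [h3]
      exact A.failLaw_update_zero_le T r b _ s (by simpa using hfs) (hE b) (hs b) (hdep b)
    calc _ ≤ ∫⁻ l, 2 * A.failLaw (f ∘ Function.update l b r) (E b) ∂(levelLaw n ρ) :=
          lintegral_mono h2
      _ = 2 * ((ρ {r})⁻¹ * (ρ {r} *
          ∫⁻ l, A.failLaw (f ∘ Function.update l b r) (E b) ∂(levelLaw n ρ))) := by
        rw [lintegral_const_mul _ Measurable.of_discrete, ← mul_assoc (ρ {r})⁻¹,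
          ENNReal.inv_mul_cancel hρ (measure_ne_top _ _), one_mul]
      _ ≤ _ := by
        rw [mul_assoc]
        gcongr
        exact mul_lintegral_update_le ρ b r fun l => A.failLaw (f ∘ l) (E b)
  refine (Finset.sum_le_sum fun b _ => h1 b).trans ?_
  rw [← Finset.mul_sum, ← lintegral_finsetSum _ fun _ _ => Measurable.of_discrete]
  gcongr
  refine (lintegral_mono hc).trans ?_
  simp

end Protocol

/-- If the best arm is uniformly random and the other arms have independent random levels, then a
non-adaptive algorithm is unlikely to find the best arm in few rounds. -/
theorem NonAdaptiveAlg.sum_lintegral_output_le {K n : ℕ} (A : NonAdaptiveAlg K n) (T R : ℕ)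
    (k : Fin K) (ρ : Measure ℕ) [IsProbabilityMeasure ρ] (hρ : ∀ r ≤ R, ρ {r} ≠ 0)
    (f : ℕ → unitInterval) (t : ℕ → ℝ≥0∞) (ht : ∀ r, t r ≠ 0) (ht' : ∀ r, t r ≠ ∞)
    (hft : ∀ r ≤ R, ENNReal.ofReal (f r) * ∑ r' ∈ Finset.range r, t r' ≤ 2⁻¹) :
    ∑ b, ∫⁻ l, A.failLaw (Function.update (f ∘ l) b 0)
        {p | (A.run T p.1 p.2 R).2 k = some b} ∂(levelLaw n ρ) ≤
      2 * (ρ {R})⁻¹ + ∑ r ∈ Finset.range R, 2 * (ρ {r})⁻¹ * ((K : ℝ≥0∞) * T / t r) := by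
  set few : ℕ → Fin n → Set (A.Seed × Protocol.Rewards K n) := fun r b =>
    ⋂ r' ∈ Finset.range r, {p | A.pulls T p.1 p.2 r' b ≤ t r'} with hfew
  have mfew : ∀ r b, MeasurableSet (few r b) := fun r b =>
    Finset.measurableSet_biInter _ fun r' _ =>
      measurableSet_le (A.measurable_pulls T r' b) measurable_const
  have sfew : ∀ r b, ∀ p ∈ few r b, ∑ r' ∈ Finset.range r, A.pulls T p.1 p.2 r' b ≤
      ∑ r' ∈ Finset.range r, t r' := by
    intro r b p hp
    refine Finset.sum_le_sum fun r' hr' => ?_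
    exact Set.mem_iInter₂.1 hp r' hr'
  have dfew : ∀ r b ω X X', (ω, X) ∈ few r b → (∀ r' ≤ r, A.run T ω X' r' = A.run T ω X r') →
      (ω, X') ∈ few r b := by
    intro r b ω X X' h h'
    refine Set.mem_iInter₂.2 fun r' hr' => ?_
    have := Set.mem_iInter₂.1 h r' hr'
    simp only [Set.mem_ofPred_eq] at this ⊢
    rwa [A.pulls_congr T ω (h' r' (Finset.mem_range.1 hr').le)]
  -- Split according to the first round in which `b` exceeds its threshold, if there is one; before
  -- that round all thresholds were respected.
  have hcover : ∀ b, {p : A.Seed × Protocol.Rewards K n | (A.run T p.1 p.2 R).2 k = some b} ⊆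
      (few R b ∩ {p | (A.run T p.1 p.2 R).2 k = some b}) ∪
        ⋃ r ∈ Finset.range R, few r b ∩ {p | t r < A.pulls T p.1 p.2 r b} := by
    intro b p hp
    by_cases h : ∃ r, r < R ∧ t r < A.pulls T p.1 p.2 r b
    · classical
      refine Or.inr (Set.mem_iUnion₂.2 ⟨Nat.find h, Finset.mem_range.2 (Nat.find_spec h).1, ?_,
        (Nat.find_spec h).2⟩)
      refine Set.mem_iInter₂.2 fun r' hr' => ?_
      have hr' := Finset.mem_range.1 hr'
      have := Nat.find_min h hr'
      exact not_lt.1 fun h2 => this ⟨hr'.trans (Nat.find_spec h).1, h2⟩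
    · push Not at h
      exact Or.inl ⟨Set.mem_iInter₂.2 fun r' hr' => h r' (Finset.mem_range.1 hr'), hp⟩
  have hsum : ∀ b, ∫⁻ l, A.failLaw (Function.update (f ∘ l) b 0)
        {p | (A.run T p.1 p.2 R).2 k = some b} ∂(levelLaw n ρ) ≤
      ∫⁻ l, A.failLaw (Function.update (f ∘ l) b 0)
        (few R b ∩ {p | (A.run T p.1 p.2 R).2 k = some b}) ∂(levelLaw n ρ) +
      ∑ r ∈ Finset.range R, ∫⁻ l, A.failLaw (Function.update (f ∘ l) b 0)
        (few r b ∩ {p | t r < A.pulls T p.1 p.2 r b}) ∂(levelLaw n ρ) := by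
    intro b
    rw [← lintegral_finsetSum _ fun _ _ => Measurable.of_discrete,
      ← lintegral_add_left Measurable.of_discrete]
    exact lintegral_mono fun l => (measure_mono (hcover b)).trans
      ((measure_union_le _ _).trans (add_le_add le_rfl (measure_biUnion_finset_le _ _)))
  refine (Finset.sum_le_sum fun b _ => hsum b).trans ?_
  rw [Finset.sum_add_distrib, Finset.sum_comm]
  refine add_le_add ?_ (Finset.sum_le_sum fun r hr => ?_)
  -- No threshold is exceeded: the constant is 1, because agent `k` has at most one output and the
  -- events for different `b` are disjoint.
  · refine (A.sum_lintegral_failLaw_le T R ρ (hρ R le_rfl) f _ 1 (hft R le_rfl) _ ?_ ?_ ?_ ?_).trans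
      (by rw [mul_one])
    · exact fun b => (mfew R b).inter ((A.measurable_run T R).2 k _)
    · exact fun b p hp => sfew R b p hp.1
    · intro b ω X X' h h'
      refine ⟨dfew R b ω X X' h.1 h', ?_⟩
      have := h.2
      simp only [Set.mem_ofPred_eq] at this ⊢
      rw [h' R le_rfl, this]
    · intro l
      rw [← measure_biUnion_finset]
      · exact prob_le_one
      · intro b _ b' _ hb
        refine Set.disjoint_left.2 fun p hp hp' => hb ?_
        have h1 := hp.2
        have h2 := hp'.2
        simp only [Set.mem_ofPred_eq] at h1 h2
        exact Option.some_injective _ (h1.symm.trans h2)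
      · exact fun b _ => (mfew R b).inter ((A.measurable_run T R).2 k _)
  · have hrR := (Finset.mem_range.1 hr).le
    refine A.sum_lintegral_failLaw_le T r ρ (hρ r hrR) f _ _ (hft r hrR) _ ?_ ?_ ?_ ?_
    · exact fun b => (mfew r b).inter (measurableSet_lt measurable_const (A.measurable_pulls T r b))
    · exact fun b p hp => sfew r b p hp.1
    · intro b ω X X' h h'
      refine ⟨dfew r b ω X X' h.1 h', ?_⟩
      have := h.2
      simp only [Set.mem_ofPred_eq] at this ⊢
      -- The excess in round `r` is already decided by the state before round `r`, so pulls of round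
      -- `r` itself reveal nothing that the event needs.
      rwa [A.pulls_congr T ω (h' r le_rfl)]
    · intro l
      -- Markov's inequality for each arm; the expectations then add up to at most the `K T` pulls
      -- available.
      have h1 : ∀ b, A.failLaw (f ∘ l) (few r b ∩ {p | t r < A.pulls T p.1 p.2 r b}) ≤
          (∫⁻ p, A.pulls T p.1 p.2 r b ∂(A.failLaw (f ∘ l))) / t r := by
        intro b
        refine le_trans (measure_mono ?_)
          (meas_ge_le_lintegral_div (A.measurable_pulls T r b).aemeasurable (ht r) (ht' r))
        exact fun p hp => le_of_lt (α := ℝ≥0∞) hp.2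
      refine (Finset.sum_le_sum fun b _ => h1 b).trans ?_
      simp only [div_eq_mul_inv]
      rw [← Finset.sum_mul, ← lintegral_finsetSum _ fun b _ => A.measurable_pulls T r b]
      gcongr
      have h2 : ∀ p : A.Seed × Protocol.Rewards K n,
          ∑ b, A.pulls T p.1 p.2 r b ≤ (K : ℝ≥0∞) * T :=
        fun p => A.sum_pulls_le_budget T p.1 p.2 r
      calc ∫⁻ p, ∑ b, A.pulls T p.1 p.2 r b ∂(A.failLaw (f ∘ l))
          ≤ ∫⁻ _, (K : ℝ≥0∞) * T ∂(A.failLaw (f ∘ l)) := lintegral_mono h2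
        _ = (K : ℝ≥0∞) * T := by rw [lintegral_const, measure_univ, mul_one]

/-! ### Bookkeeping for centralized runs. -/

namespace CentralizedAlg

variable {n : ℕ}

/-- The arm that is pulled at time `t`. -/
def action (O : CentralizedAlg n) (T : ℕ) (ω : O.Seed) (X : Fin n × ℕ → unitInterval) (t : ℕ) :
    Fin n := O.pull T t ω (O.run T ω X t).1

variable (O : CentralizedAlg n) (T : ℕ) (ω : O.Seed) (X : Fin n × ℕ → unitInterval)

theorem run_succ_fst (t : ℕ) : (O.run T ω X (t + 1)).1 = Function.update (O.run T ω X t).1 t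
    (X (O.action T ω X t, (O.run T ω X t).2 (O.action T ω X t))) := rfl

theorem run_succ_snd (t : ℕ) : (O.run T ω X (t + 1)).2 = Function.update (O.run T ω X t).2
    (O.action T ω X t) ((O.run T ω X t).2 (O.action T ω X t) + 1) := rfl

theorem run_fst_eq_of_lt {s t t' : ℕ} (hs : s < t) (ht : t ≤ t') :
    (O.run T ω X t').1 s = (O.run T ω X t).1 s := by
  induction t', ht using Nat.le_induction with
  | base => rfl
  | succ t' ht ih => rw [run_succ_fst, Function.update_of_ne (by omega), ih]

theorem run_snd_eq (t : ℕ) (i : Fin n) : (O.run T ω X t).2 i =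
    ∑ s ∈ Finset.range t, if O.action T ω X s = i then 1 else 0 := by
  induction t with
  | zero => rfl
  | succ t ih =>
    rw [Finset.sum_range_succ, ← ih, run_succ_snd, Function.update_apply]
    by_cases h : O.action T ω X t = i
    · simp [h]
    · simp [h, Ne.symm h]

/-- The pulls of arm `i` read its reward sequence in order. This turns sums over the times of an
adaptive run into sums over a prefix of independent rewards. -/
theorem sum_outcomes_eq (i : Fin n) {t t' : ℕ} (ht : t ≤ t') :
    (∑ s ∈ Finset.range t, if O.action T ω X s = i then ((O.run T ω X t').1 s : ℝ) else 0) =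
      ∑ u ∈ Finset.range ((O.run T ω X t).2 i), (X (i, u) : ℝ) := by
  induction t with
  | zero => rfl
  | succ t ih =>
    rw [Finset.sum_range_succ, ih (by omega), run_succ_snd, Function.update_apply,
      O.run_fst_eq_of_lt T ω X (Nat.lt_succ_self t) ht, run_succ_fst, Function.update_self]
    by_cases h : O.action T ω X t = i
    · simp [h, Finset.sum_range_succ]
    · simp [h, Ne.symm h]

end CentralizedAlg

/-! ### Successive Rejects: schedule, budget and correctness. -/

theorem sum_range_mul {M : Type*} [AddCommMonoid M] (m r : ℕ) (g : ℕ → M) :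
    ∑ s ∈ Finset.range (m * r), g s =
      ∑ p ∈ Finset.range m, ∑ u ∈ Finset.range r, g (p * r + u) := by
  induction m with
  | zero => simp
  | succ m ih => rw [Nat.succ_mul, Finset.sum_range_add, ih, Finset.sum_range_succ]

/-- Removing the smallest element makes a list shorter by one. -/
theorem length_filter_exists_lt {α β : Type*} [LinearOrder β] {l : List α} (hl : l.Nodup)
    (hne : l ≠ []) (φ : α → β) (hφ : Function.Injective φ) (p : α → Bool)
    (hp : ∀ i, p i = true ↔ ∃ j ∈ l, φ j < φ i) : (l.filter p).length = l.length - 1 := by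
  classical
  obtain ⟨m, hm, hmin⟩ := l.toFinset.exists_min_image φ
    (by simpa [List.toFinset_nonempty_iff] using hne)
  rw [List.mem_toFinset] at hm
  have h : l.filter p = l.filter (· != m) := by
    refine List.filter_congr fun i hi => ?_
    rw [Bool.eq_iff_iff, hp, bne_iff_ne]
    constructor
    · rintro ⟨j, hj, hlt⟩ rfl
      exact absurd (hmin j (List.mem_toFinset.2 hj)) (not_le.2 hlt)
    · intro hne
      exact ⟨m, hm, lt_of_le_of_ne (hmin i (List.mem_toFinset.2 hi))
        fun h => hne (hφ h).symm⟩
  rw [h, ← hl.erase_eq_filter, List.length_erase_of_mem hm]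

namespace SR

variable {n T : ℕ}

theorem state_succ_snd (h : ℕ → unitInterval) (k : ℕ) (i : Fin n) :
    (state n T h (k + 1)).2 i = (state n T h k).2 i + ∑ u ∈ Finset.range (reps n T k),
      (h (start n T k + (state n T h k).1.idxOf i * reps n T k + u) : ℝ) := rfl

open Classical in
theorem state_succ_fst (h : ℕ → unitInterval) (k : ℕ) :
    (state n T h (k + 1)).1 = (state n T h k).1.filter fun i => ∃ j ∈ (state n T h k).1,
      (state n T h (k + 1)).2 j < (state n T h (k + 1)).2 i ∨
        ((state n T h (k + 1)).2 j = (state n T h (k + 1)).2 i ∧ j < i) := rfl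

theorem mem_of_mem_state_succ {h : ℕ → unitInterval} {k : ℕ} {i : Fin n}
    (hi : i ∈ (state n T h (k + 1)).1) : i ∈ (state n T h k).1 := by
  rw [state_succ_fst] at hi
  exact List.mem_of_mem_filter hi

theorem nodup_state (h : ℕ → unitInterval) (k : ℕ) : (state n T h k).1.Nodup := by
  induction k with
  | zero => exact List.nodup_finRange n
  | succ k ih => rw [state_succ_fst]; exact ih.filter _

/-- Breaking ties by the index is the lexicographic order on pairs (sum, index), which is injective
in the arm; so every phase removes exactly one arm. -/
theorem length_state (h : ℕ → unitInterval) {k : ℕ} (hk : k ≤ n) :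
    (state n T h k).1.length = n - k := by
  induction k with
  | zero => simp [state]
  | succ k ih =>
    have ih := ih (by omega)
    rw [state_succ_fst, length_filter_exists_lt (nodup_state h k) _
      (fun i => toLex ((state n T h (k + 1)).2 i, i)), ih, Nat.sub_sub]
    · intro i j hij
      simpa using congrArg (fun x => (ofLex x).2) hij
    · intro i
      simp [Prod.Lex.toLex_lt_toLex]
    · intro h0
      rw [h0] at ih
      simp at ih
      omega

theorem start_succ (k : ℕ) : start n T (k + 1) = start n T k + (n - k) * reps n T k := by
  rw [start, Finset.sum_range_succ, start]

theorem start_mono : Monotone (start n T) :=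
  monotone_nat_of_le_succ fun k => by rw [start_succ]; omega

/-- The list of active arms depends only on the outcomes of the previous phases. -/
theorem state_congr {h h' : ℕ → unitInterval} {k : ℕ} (hk : k ≤ n)
    (hh : ∀ s < start n T k, h s = h' s) :
    (state n T h k).1 = (state n T h' k).1 ∧
      ∀ i ∈ (state n T h k).1, (state n T h k).2 i = (state n T h' k).2 i := by
  induction k with
  | zero => exact ⟨rfl, fun _ _ => rfl⟩
  | succ k ih =>
    obtain ⟨ih1, ih2⟩ := ih (by omega) fun s hs => hh s (hs.trans_le (start_mono (Nat.le_succ k)))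
    have h2 : ∀ i ∈ (state n T h k).1,
        (state n T h (k + 1)).2 i = (state n T h' (k + 1)).2 i := by
      intro i hi
      rw [state_succ_snd, state_succ_snd, ih2 i hi, ← ih1]
      congr 1
      refine Finset.sum_congr rfl fun u hu => ?_
      rw [hh]
      have h3 : (state n T h k).1.idxOf i < n - k := by
        rw [← length_state h (by omega : k ≤ n)]
        exact List.idxOf_lt_length_of_mem hi
      rw [start_succ]
      have h4 : ((state n T h k).1.idxOf i + 1) * reps n T k ≤ (n - k) * reps n T k :=
        Nat.mul_le_mul_right _ h3
      rw [Nat.succ_mul] at h4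
      have := Finset.mem_range.1 hu
      omega
    refine ⟨?_, fun i hi => h2 i (mem_of_mem_state_succ hi)⟩
    rw [state_succ_fst, state_succ_fst, ← ih1]
    refine List.filter_congr fun i hi => ?_
    rw [decide_eq_decide]
    refine exists_congr fun j => and_congr_right fun hj => ?_
    rw [h2 i hi, h2 j hj]

theorem phase_eq {k t : ℕ} (hk : k < n - 1) (h1 : start n T k ≤ t) (h2 : t < start n T (k + 1)) :
    phase n T t = k := by
  have : ((Finset.range (n - 1)).filter fun j => start n T (j + 1) ≤ t) = Finset.range k := by
    ext j
    simp only [Finset.mem_filter, Finset.mem_range]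
    constructor
    · rintro ⟨-, h3⟩
      by_contra h4
      exact absurd (h2.trans_le (start_mono (by omega : k + 1 ≤ j + 1))) (not_lt.2 h3)
    · intro h3
      exact ⟨by omega, (start_mono (by omega : j + 1 ≤ k)).trans h1⟩
  rw [phase, this, Finset.card_range]

theorem logBar_pos : 0 < logBar n := by
  unfold logBar; positivity

theorem cum_mono (hT : n ≤ T) {k : ℕ} (hk : k + 1 ≤ n) : cum n T k ≤ cum n T (k + 1) := by
  by_cases h : k = 0
  · simp [cum, h]
  · rw [cum, cum, if_neg h, if_neg k.succ_ne_zero]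
    have h1 : (0 : ℝ) ≤ (T : ℝ) - n := by
      have : (n : ℝ) ≤ T := by exact_mod_cast hT
      linarith
    have h2 : ((k + 1 : ℕ) : ℝ) ≤ n := by exact_mod_cast hk
    push_cast at h2 ⊢
    refine Nat.ceil_mono (div_le_div_of_nonneg_left h1 ?_ ?_)
    · exact mul_pos logBar_pos (by linarith)
    · exact mul_le_mul_of_nonneg_left (by linarith) logBar_pos.le

theorem cum_add_reps (hT : n ≤ T) {k : ℕ} (hk : k + 1 ≤ n) :
    cum n T k + reps n T k = cum n T (k + 1) := by
  have := cum_mono hT hk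
  unfold reps
  omega

/-- Count by arms instead of by phases: the arm rejected in phase `j` accounts for `cum n T (j + 1)`
pulls, each of the `n - k` survivors for `cum n T k`. -/
theorem start_eq (hT : n ≤ T) {k : ℕ} (hk : k ≤ n) :
    start n T k = ∑ j ∈ Finset.range k, cum n T (j + 1) + (n - k) * cum n T k := by
  induction k with
  | zero => simp [start, cum]
  | succ k ih =>
    have h1 : n - k = (n - (k + 1)) + 1 := by omega
    rw [start_succ, ih (by omega), Finset.sum_range_succ, add_assoc, ← mul_add,
      cum_add_reps hT hk, h1]
    ring

/-- The pulls of all phases fit into the time budget. -/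
theorem start_le (hn : 2 ≤ n) (hT : n ≤ T) : start n T (n - 1) ≤ T := by
  have hT' : (0 : ℝ) ≤ (T : ℝ) - n := by
    have : (n : ℝ) ≤ T := by exact_mod_cast hT
    linarith
  set x : ℝ := ((T : ℝ) - n) / logBar n with hx
  have hx0 : 0 ≤ x := div_nonneg hT' logBar_pos.le
  have hcum : ∀ j, j < n → 1 ≤ j → (cum n T j : ℝ) ≤ x * (1 / ((n : ℝ) + 1 - j)) + 1 := by
    intro j hj hj0
    have hj' : (j : ℝ) < n := by exact_mod_cast hj
    rw [cum, if_neg (by omega)]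
    refine (Nat.ceil_lt_add_one ?_).le.trans (le_of_eq ?_)
    · exact div_nonneg hT' (mul_pos logBar_pos (by linarith)).le
    · rw [hx, div_mul_div_comm, mul_one]
  have hsum : ∑ j ∈ Finset.range (n - 1), (1 : ℝ) / ((n : ℝ) + 1 - ((j + 1 : ℕ) : ℝ)) =
      ∑ i ∈ Finset.Icc 2 n, (1 : ℝ) / i := by
    have hI : Finset.Icc 2 n = Finset.Ico 2 (n + 1) := by ext; simp
    rw [← Finset.sum_range_reflect, hI, Finset.sum_Ico_eq_sum_range]
    refine Finset.sum_congr rfl fun j hj => ?_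
    have := Finset.mem_range.1 hj
    congr 1
    rw [show n - 1 - 1 - j + 1 = n - (1 + j) by omega, Nat.cast_sub (by omega)]
    push_cast
    ring
  have hmain : (start n T (n - 1) : ℝ) ≤ T := by
    rw [start_eq hT (by omega), show n - (n - 1) = 1 by omega, one_mul]
    push_cast
    have h1 : ∑ j ∈ Finset.range (n - 1), (cum n T (j + 1) : ℝ) ≤
        ∑ j ∈ Finset.range (n - 1), (x * (1 / ((n : ℝ) + 1 - ((j + 1 : ℕ) : ℝ))) + 1) :=
      Finset.sum_le_sum fun j hj => hcum (j + 1) (by have := Finset.mem_range.1 hj; omega) (by omega)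
    rw [Finset.sum_add_distrib, ← Finset.mul_sum, hsum, Finset.sum_const, Finset.card_range,
      nsmul_eq_mul, mul_one] at h1
    -- The last survivor contributes the summand `1/2` of `logBar`. The `n` ceilings cost at most
    -- one pull each, which the `- n` in the numerator pays for.
    have h2 := hcum (n - 1) (by omega) (by omega)
    rw [Nat.cast_sub (by omega)] at h1 h2
    have h3 : (n : ℝ) + 1 - (n - (1 : ℕ)) = 2 := by push_cast; ring
    rw [h3] at h2
    have h4 : x * logBar n = T - n := div_mul_cancel₀ _ logBar_pos.ne'
    rw [logBar] at h4
    push_cast at h1 h2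
    linarith
  exact_mod_cast hmain

end SR

namespace SR

variable {n T : ℕ}

/-- The list of active arms is frozen by the outcomes before the phase, so computing it from a later
history gives the list that the algorithm actually used. -/
theorem action_eq (hn : 0 < n) (ω : (successiveRejects n hn).Seed)
    (X : Fin n × ℕ → unitInterval) {k p u t' : ℕ}
    (hk : k < n - 1) (hp : p < n - k) (hu : u < reps n T k)
    (ht : start n T k + p * reps n T k + u ≤ t') :
    (successiveRejects n hn).action T ω X (start n T k + p * reps n T k + u) =
      (state n T ((successiveRejects n hn).run T ω X t').1 k).1.getD p ⟨0, hn⟩ := by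
  have h1 : start n T k + p * reps n T k + u < start n T (k + 1) := by
    have h4 : (p + 1) * reps n T k ≤ (n - k) * reps n T k := Nat.mul_le_mul_right _ hp
    rw [Nat.succ_mul] at h4
    rw [start_succ]
    omega
  have h2 : phase n T (start n T k + p * reps n T k + u) = k := phase_eq hk (by omega) h1
  have h3 : (start n T k + p * reps n T k + u - start n T k) / reps n T k = p := by
    rw [Nat.add_assoc, Nat.add_sub_cancel_left, Nat.mul_comm, Nat.mul_add_div (by omega),
      Nat.div_eq_of_lt hu, Nat.add_zero]
  change (state n T ((successiveRejects n hn).run T ω X _).1 (phase n T _)).1.getD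
    ((_ - start n T (phase n T _)) / reps n T (phase n T _)) _ = _
  rw [h2, h3]
  congr 1
  refine (state_congr (by omega) fun s hs => ?_).1
  exact ((successiveRejects n hn).run_fst_eq_of_lt T ω X (by omega) ht).symm

/-- An active arm is pulled `reps n T k` times in phase `k`, at the times at which its outcomes are
read off. -/
theorem sum_phase_eq {M : Type*} [AddCommMonoid M] (hn : 0 < n) (ω : (successiveRejects n hn).Seed)
    (X : Fin n × ℕ → unitInterval) {k t' : ℕ} (hk : k < n - 1) (ht : start n T (k + 1) ≤ t')
    {i : Fin n} (hi : i ∈ (state n T ((successiveRejects n hn).run T ω X t').1 k).1) (g : ℕ → M) :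
    (∑ s ∈ Finset.range ((n - k) * reps n T k),
      if (successiveRejects n hn).action T ω X (start n T k + s) = i then g (start n T k + s) else 0)
      = ∑ u ∈ Finset.range (reps n T k), g (start n T k +
        (state n T ((successiveRejects n hn).run T ω X t').1 k).1.idxOf i * reps n T k + u) := by
  set l := (state n T ((successiveRejects n hn).run T ω X t').1 k).1 with hl
  have hlen : l.length = n - k := length_state _ (by omega)
  have hnd : l.Nodup := nodup_state _ _
  have hidx : l.idxOf i < n - k := hlen ▸ List.idxOf_lt_length_of_mem hi
  rw [sum_range_mul, Finset.sum_eq_single (l.idxOf i)]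
  · refine Finset.sum_congr rfl fun u hu => ?_
    have hu := Finset.mem_range.1 hu
    have h4 : (l.idxOf i + 1) * reps n T k ≤ (n - k) * reps n T k := Nat.mul_le_mul_right _ hidx
    rw [Nat.succ_mul] at h4
    have h5 := start_succ (n := n) (T := T) k
    rw [← Nat.add_assoc, action_eq hn ω X hk hidx hu (t' := t') (by omega), ← hl,
      List.getD_eq_getElem _ _ (hlen ▸ hidx), List.getElem_idxOf, if_pos rfl]
  · intro p hp hne
    have hp := Finset.mem_range.1 hp
    refine Finset.sum_eq_zero fun u hu => ?_
    have hu := Finset.mem_range.1 hu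
    have h4 : (p + 1) * reps n T k ≤ (n - k) * reps n T k := Nat.mul_le_mul_right _ hp
    rw [Nat.succ_mul] at h4
    have h5 := start_succ (n := n) (T := T) k
    rw [← Nat.add_assoc, action_eq hn ω X hk hp hu (t' := t') (by omega), ← hl, if_neg]
    rw [List.getD_eq_getElem _ _ (hlen ▸ hp)]
    rintro rfl
    exact hne (hnd.idxOf_getElem _ _).symm
  · intro h
    exact absurd (Finset.mem_range.2 hidx) h

/-- Only activity at the start of phase `k` is assumed, so that the arm rejected at its end is
covered too; the comparison of sums needs this. -/
theorem counts_succ (hn : 2 ≤ n) (hn0 : 0 < n) (hT : n ≤ T) (ω : (successiveRejects n hn0).Seed)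
    (X : Fin n × ℕ → unitInterval) {k : ℕ} (hk : k + 1 ≤ n - 1) {i : Fin n}
    (hi : i ∈ (state n T ((successiveRejects n hn0).run T ω X T).1 k).1)
    (h1 : ((successiveRejects n hn0).run T ω X (start n T k)).2 i = cum n T k)
    (h2 : (state n T ((successiveRejects n hn0).run T ω X T).1 k).2 i =
      ∑ u ∈ Finset.range (cum n T k), (X (i, u) : ℝ)) :
    ((successiveRejects n hn0).run T ω X (start n T (k + 1))).2 i = cum n T (k + 1) ∧
      (state n T ((successiveRejects n hn0).run T ω X T).1 (k + 1)).2 i =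
        ∑ u ∈ Finset.range (cum n T (k + 1)), (X (i, u) : ℝ) := by
  have hst : start n T (k + 1) ≤ T := (start_mono hk).trans (start_le hn hT)
  have hc : ((successiveRejects n hn0).run T ω X (start n T (k + 1))).2 i = cum n T (k + 1) := by
    rw [CentralizedAlg.run_snd_eq, start_succ, Finset.sum_range_add,
      ← CentralizedAlg.run_snd_eq, h1,
      sum_phase_eq hn0 ω X (t' := T) (by omega) hst hi (fun _ => (1 : ℕ)), Finset.sum_const,
      Finset.card_range, smul_eq_mul, mul_one, cum_add_reps hT (by omega)]
  refine ⟨hc, ?_⟩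
  have h3 := sum_phase_eq hn0 ω X (t' := T) (by omega) hst hi
    (fun s => (((successiveRejects n hn0).run T ω X T).1 s : ℝ))
  have h4 := (successiveRejects n hn0).sum_outcomes_eq T ω X i hst
  have h5 := (successiveRejects n hn0).sum_outcomes_eq T ω X i
    ((start_mono (Nat.le_succ k)).trans hst)
  rw [hc, start_succ, Finset.sum_range_add, h5, h1] at h4
  rw [state_succ_snd, h2, ← h4, ← h3]

/-- Every active arm has been pulled `cum n T k` times in the first `k` phases, and the state holds
the sum of the outcomes. -/
theorem counts_eq (hn : 2 ≤ n) (hn0 : 0 < n) (hT : n ≤ T) (ω : (successiveRejects n hn0).Seed)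
    (X : Fin n × ℕ → unitInterval) {k : ℕ} (hk : k ≤ n - 1) {i : Fin n}
    (hi : i ∈ (state n T ((successiveRejects n hn0).run T ω X T).1 k).1) :
    ((successiveRejects n hn0).run T ω X (start n T k)).2 i = cum n T k ∧
      (state n T ((successiveRejects n hn0).run T ω X T).1 k).2 i =
        ∑ u ∈ Finset.range (cum n T k), (X (i, u) : ℝ) := by
  induction k with
  | zero => exact ⟨by simp [start, cum, CentralizedAlg.run], by simp [state, cum]⟩
  | succ k ih =>
    have hi' := mem_of_mem_state_succ hi
    obtain ⟨ih1, ih2⟩ := ih (by omega) hi'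
    exact counts_succ hn hn0 hT ω X hk hi' ih1 ih2

/-- If the best arm never fails and in every phase some other active arm fails, then Successive
Rejects outputs the best arm. -/
theorem output_eq (hn : 2 ≤ n) (hn0 : 0 < n) (hT : n ≤ T) (ω : (successiveRejects n hn0).Seed)
    (X : Fin n × ℕ → unitInterval) (b : Fin n)
    (m : Fin n → ℕ) (hb : ∀ u, X (b, u) = 1) (hm : ∀ i ≠ b, ∃ u < m i, X (i, u) ≠ 1)
    (hS : ∀ k < n - 1, ∀ S : Finset (Fin n), b ∈ S → S.card = n - k →
      ∃ i ∈ S, i ≠ b ∧ m i ≤ cum n T (k + 1)) :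
    (successiveRejects n hn0).output T ω
      ((successiveRejects n hn0).run T ω X T).1 = b := by
  classical
  set H := ((successiveRejects n hn0).run T ω X T).1 with hH
  have hmem : ∀ k ≤ n - 1, b ∈ (state n T H k).1 := by
    intro k
    induction k with
    | zero => intro _; exact List.mem_finRange b
    | succ k ih =>
      intro hk
      have hbk := ih (by omega)
      obtain ⟨i, hi, hib, hmi⟩ := hS k (by omega) (state n T H k).1.toFinset
        (List.mem_toFinset.2 hbk)
        (by rw [List.toFinset_card_of_nodup (nodup_state H k), length_state H (by omega)])
      have hi := List.mem_toFinset.1 hi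
      have hsum : ∀ j ∈ (state n T H k).1, (state n T H (k + 1)).2 j =
          ∑ u ∈ Finset.range (cum n T (k + 1)), (X (j, u) : ℝ) := by
        intro j hj
        obtain ⟨h1, h2⟩ := counts_eq hn hn0 hT ω X (by omega) hj
        exact (counts_succ hn hn0 hT ω X hk hj h1 h2).2
      rw [state_succ_fst, List.mem_filter]
      -- Arm `b` has the maximal possible sum, and the active arm `i` has failed within its pulls so
      -- far, so its sum is strictly smaller and `b` is not rejected.
      refine ⟨hbk, decide_eq_true ⟨i, hi, Or.inl ?_⟩⟩
      rw [hsum i hi, hsum b hbk]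
      obtain ⟨u, hu, hXu⟩ := hm i hib
      refine Finset.sum_lt_sum (fun v _ => ?_) ⟨u, Finset.mem_range.2 (hu.trans_le hmi), ?_⟩
      · rw [hb]; exact (X (i, v)).2.2
      · rw [hb]
        exact lt_of_le_of_ne (X (i, u)).2.2 fun h => hXu (Subtype.ext h)
  have hlen : (state n T H (n - 1)).1.length = 1 := by
    rw [length_state H (by omega)]; omega
  obtain ⟨a, ha⟩ := List.length_eq_one_iff.1 hlen
  have hba := hmem (n - 1) le_rfl
  change (state n T H (n - 1)).1.headD _ = b
  rw [ha] at hba ⊢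
  exact (List.mem_singleton.1 hba).symm

end SR

/-! ### Error of Successive Rejects on instances with a perfect arm. -/

/-- The instance in which arm `b` never fails and every other arm `i` fails with probability
`q i > 0`. -/
def failInstance {n : ℕ} (b : Fin n) (q : Fin n → unitInterval) (hb : q b = 0)
    (hq : ∀ i ≠ b, 0 < q i) : Instance n where
  arm i := rewardLaw (q i)
  isProb i := inferInstance
  best := b
  isBest i hi := by
    rw [integral_rewardLaw, integral_rewardLaw, hb]
    have : (0 : ℝ) < q i := hq i hi
    simpa using this

theorem infinitePi_forall_eq_one {n : ℕ} (q : Fin n → unitInterval) (i : Fin n) (m : ℕ) :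
    Measure.infinitePi (fun p : Fin n × ℕ => rewardLaw (q p.1)) {X | ∀ u < m, X (i, u) = 1} =
      ENNReal.ofReal (1 - q i) ^ m := by
  classical
  have h : {X : Fin n × ℕ → unitInterval | ∀ u < m, X (i, u) = 1} =
      (((Finset.range m).image fun u => (i, u) : Finset (Fin n × ℕ)) :
        Set (Fin n × ℕ)).pi fun _ => {1} := by
    ext X
    simp
  rw [h, Measure.infinitePi_pi _ fun _ _ => measurableSet_singleton 1,
    Finset.prod_image fun _ _ _ _ h => (Prod.mk.inj h).2]
  simp [rewardLaw_one_eq]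

/-- The error probability of Successive Rejects if enough arms have failed in every phase with high
probability. -/
theorem error_successiveRejects_le {n T : ℕ} (hn : 2 ≤ n) (hn0 : 0 < n) (hT : n ≤ T) (b : Fin n)
    (q : Fin n → unitInterval) (hb : q b = 0) (hq : ∀ i ≠ b, 0 < q i) (m : Fin n → ℕ)
    (hS : ∀ k < n - 1, ∀ S : Finset (Fin n), b ∈ S → S.card = n - k →
      ∃ i ∈ S, i ≠ b ∧ m i ≤ SR.cum n T (k + 1)) :
    (successiveRejects n hn0).error (failInstance b q hb hq) T ≤
      ∑ i ∈ Finset.univ.erase b, ENNReal.ofReal (1 - q i) ^ m i := by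
  classical
  set μ := Measure.infinitePi (fun p : Fin n × ℕ => rewardLaw (q p.1)) with hμ
  have hsub : {p | (successiveRejects n hn0).output T p.1
      ((successiveRejects n hn0).run T p.1 p.2 T).1 ≠ b} ⊆
      Set.univ ×ˢ ((⋃ u : ℕ, {X : Fin n × ℕ → unitInterval | X (b, u) ∈ {x | x ≠ 1}}) ∪
        ⋃ i ∈ Finset.univ.erase b, {X | ∀ u < m i, X (i, u) = 1}) := by
    rintro ⟨ω, X⟩ hp
    refine ⟨trivial, ?_⟩
    by_contra h
    rw [Set.mem_union, not_or] at h
    refine hp (SR.output_eq hn hn0 hT ω X b m (fun u => ?_) (fun i hi => ?_) hS)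
    · by_contra h1
      exact h.1 (Set.mem_iUnion.2 ⟨u, h1⟩)
    · by_contra h1
      push Not at h1
      exact h.2 (Set.mem_iUnion₂.2 ⟨i, by simpa using hi, h1⟩)
  have h0 : μ (⋃ u : ℕ, {X : Fin n × ℕ → unitInterval | X (b, u) ∈ {x | x ≠ 1}}) = 0 := by
    refine measure_iUnion_null fun u => ?_
    have := infinitePi_inter_coord (fun p : Fin n × ℕ => rewardLaw (q p.1)) (b, u)
      MeasurableSet.univ (by simp) (A := {x | x ≠ 1}) (by measurability)
    rw [Set.univ_inter, rewardLaw_ne_one] at this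
    simp only [this, hμ, hb]
    simp
  refine (measure_mono hsub).trans ?_
  rw [Measure.prod_prod, measure_univ, one_mul]
  refine (measure_union_le _ _).trans ?_
  change μ _ + μ _ ≤ _
  rw [h0, zero_add]
  refine (measure_biUnion_finset_le _ _).trans (Finset.sum_le_sum fun i _ => ?_)
  rw [hμ, infinitePi_forall_eq_one]

/-! ### From expected rounds to early correct outputs. -/

namespace Protocol

variable {K n : ℕ}

theorem one_le_numRounds (A : Protocol K n) (hK : 1 ≤ K) (T : ℕ) (ω : A.Seed) (X : Rewards K n) :
    1 ≤ A.numRounds T ω X := by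
  refine le_iInf₂ fun r hr => ?_
  rcases Nat.eq_zero_or_pos r with rfl | h
  · exact absurd rfl (hr ⟨0, hK⟩)
  · exact_mod_cast h

theorem measure_univ_eq_one (A : Protocol K n) (I : Instance n) : A.measure I Set.univ = 1 := by
  have : IsProbabilityMeasure (A.measure I) := by unfold measure; infer_instance
  exact measure_univ

theorem one_le_expectedRounds (A : Protocol K n) (hK : 1 ≤ K) (I : Instance n) (T : ℕ) :
    1 ≤ A.expectedRounds I T := by
  calc (1 : ℝ≥0∞) = ∫⁻ _, 1 ∂(A.measure I) := by rw [lintegral_const, measure_univ_eq_one, one_mul]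
    _ ≤ _ := lintegral_mono fun p => A.one_le_numRounds hK T p.1 p.2

/-- If an algorithm does not err and terminates quickly, then it has found the best arm early. -/
theorem one_le_measure_output (A : Protocol K n) (I : Instance n) (T R : ℕ) (k : Fin K) :
    1 ≤ A.measure I {p | (A.run T p.1 p.2 R).2 k = some I.best} + A.error I T +
      A.expectedRounds I T / ((R : ℝ≥0∞) + 1) := by
  set S := ⋃ k, {p : A.Seed × Rewards K n | (A.run T p.1 p.2 R).2 k = none} with hS
  have mS : MeasurableSet S := MeasurableSet.iUnion fun k => (A.measurable_run T R).2 k none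
  -- Markov's inequality: outputs are permanent, so an agent without one after `R` rounds forces at
  -- least `R + 1` rounds.
  have h1 : ((R : ℝ≥0∞) + 1) * A.measure I S ≤ A.expectedRounds I T := by
    rw [← lintegral_indicator_const mS]
    refine lintegral_mono fun p => ?_
    by_cases hp : p ∈ S
    · rw [Set.indicator_of_mem hp]
      obtain ⟨k, hk⟩ := Set.mem_iUnion.1 hp
      refine le_iInf₂ fun r hr => ?_
      have : R + 1 ≤ r := by
        by_contra h
        obtain ⟨a, ha⟩ := Option.ne_none_iff_exists'.1 (hr k)
        have := A.run_eq_some_of_le T p.1 p.2 (by omega : r ≤ R) ha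
        rw [Set.mem_ofPred_eq, this] at hk
        exact Option.some_ne_none a hk
      exact_mod_cast this
    · rw [Set.indicator_of_notMem hp]
      exact zero_le
  have h2 : A.measure I S ≤ A.expectedRounds I T / ((R : ℝ≥0∞) + 1) := by
    rw [ENNReal.le_div_iff_mul_le (Or.inl (by simp)) (Or.inl (by finiteness)), mul_comm]
    exact h1
  have h3 : Set.univ ⊆ ({p | (A.run T p.1 p.2 R).2 k = some I.best} ∪
      {p | ¬ ∀ k, ∃ r, (A.run T p.1 p.2 r).2 k = some I.best}) ∪ S := by
    intro p _
    by_cases hp : p ∈ S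
    · exact Or.inr hp
    refine Or.inl ?_
    by_cases he : ∀ k, ∃ r, (A.run T p.1 p.2 r).2 k = some I.best
    · refine Or.inl ?_
      obtain ⟨r, hr⟩ := he k
      have hk : (A.run T p.1 p.2 R).2 k ≠ none := fun h => hp (Set.mem_iUnion.2 ⟨k, h⟩)
      obtain ⟨a, ha⟩ := Option.ne_none_iff_exists'.1 hk
      have h4 := A.run_eq_some_of_le T p.1 p.2 (le_max_left r R) hr
      have h5 := A.run_eq_some_of_le T p.1 p.2 (le_max_right r R) ha
      rw [Set.mem_ofPred_eq, ha, ← h5, h4]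
    · exact Or.inr he
  calc (1 : ℝ≥0∞) = A.measure I Set.univ := (A.measure_univ_eq_one I).symm
    _ ≤ _ := (measure_mono h3).trans ((measure_union_le _ _).trans
      (add_le_add (measure_union_le _ _) h2))

end Protocol

/-! ### The law of the levels -/

/-- The law of a level: a geometric distribution, truncated at `R`. -/
def truncGeom (y : ℝ) (R : ℕ) : Measure ℕ :=
  ∑ l ∈ Finset.range R, ENNReal.ofReal (y ^ l - y ^ (l + 1)) • Measure.dirac l +
    ENNReal.ofReal (y ^ R) • Measure.dirac R

/-- The atoms telescope, and the atom at `R` carries the whole remaining tail, so truncation leaves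
these tails exactly geometric. -/
theorem truncGeom_Ici {y : ℝ} (h0 : 0 ≤ y) (h1 : y ≤ 1) {R l : ℕ} (hl : l ≤ R) :
    truncGeom y R (Set.Ici l) = ENNReal.ofReal (y ^ l) := by
  have hnn : ∀ j, 0 ≤ y ^ j - y ^ (j + 1) := fun j => by
    rw [pow_succ]
    nlinarith [pow_nonneg h0 j]
  have h2 : ∑ j ∈ Finset.range R, ENNReal.ofReal (y ^ j - y ^ (j + 1)) *
      (Set.Ici l).indicator 1 j = ENNReal.ofReal (y ^ l - y ^ R) := by
    have h3 : ∀ j, ENNReal.ofReal (y ^ j - y ^ (j + 1)) * (Set.Ici l).indicator 1 j =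
        if l ≤ j then ENNReal.ofReal (y ^ j - y ^ (j + 1)) else 0 := fun j => by
      by_cases h : l ≤ j <;> simp [h]
    have h4 : (Finset.range R).filter (fun j => l ≤ j) = Finset.Ico l R := by
      ext j; simp [and_comm]
    simp only [h3]
    rw [← Finset.sum_filter, h4, ← ENNReal.ofReal_sum_of_nonneg fun j _ => hnn j]
    congr 1
    rw [Finset.sum_Ico_eq_sum_range]
    have := Finset.sum_range_sub' (fun j => y ^ (l + j)) (R - l)
    simpa [Nat.add_sub_cancel' hl, add_assoc] using this
  have h5 : y ^ R ≤ y ^ l := pow_le_pow_of_le_one h0 h1 hl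
  simp only [truncGeom, Measure.coe_add, Pi.add_apply, Measure.coe_finsetSum, Finset.sum_apply,
    Measure.coe_smul, Pi.smul_apply, smul_eq_mul, Measure.dirac_apply' _ measurableSet_Ici, h2]
  rw [Set.indicator_of_mem (Set.mem_Ici.2 hl), Pi.one_apply, mul_one,
    ← ENNReal.ofReal_add (by linarith) (pow_nonneg h0 R)]
  congr 1
  ring

theorem isProbabilityMeasure_truncGeom {y : ℝ} (h0 : 0 ≤ y) (h1 : y ≤ 1) (R : ℕ) :
    IsProbabilityMeasure (truncGeom y R) := by
  constructor
  have := truncGeom_Ici h0 h1 (Nat.zero_le R)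
  have hI : Set.Ici (0 : ℕ) = Set.univ := by ext; simp
  rw [hI] at this
  simpa using this

/-- Since `y ≤ 1/2`, a single level carries at least half of the mass of its tail; this bounds the
cost of conditioning on level `r`. -/
theorem le_truncGeom_singleton {y : ℝ} (h0 : 0 ≤ y) (h1 : y ≤ 1 / 2) {R r : ℕ} (hr : r ≤ R) :
    ENNReal.ofReal (y ^ r / 2) ≤ truncGeom y R {r} := by
  have hp := pow_nonneg h0 r
  rcases hr.lt_or_eq with h | rfl
  · calc ENNReal.ofReal (y ^ r / 2) ≤ ENNReal.ofReal (y ^ r - y ^ (r + 1)) := by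
          refine ENNReal.ofReal_le_ofReal ?_
          rw [pow_succ]
          nlinarith
      _ = ENNReal.ofReal (y ^ r - y ^ (r + 1)) * Measure.dirac r {r} := by simp
      _ ≤ ∑ l ∈ Finset.range R, ENNReal.ofReal (y ^ l - y ^ (l + 1)) * Measure.dirac l {r} :=
          Finset.single_le_sum (f := fun l => ENNReal.ofReal (y ^ l - y ^ (l + 1)) *
            Measure.dirac l {r}) (fun _ _ => zero_le) (Finset.mem_range.2 h)
      _ ≤ _ := by
        simp only [truncGeom, Measure.coe_add, Pi.add_apply, Measure.coe_finsetSum,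
          Finset.sum_apply, Measure.coe_smul, Pi.smul_apply, smul_eq_mul]
        exact le_self_add
  · calc ENNReal.ofReal (y ^ r / 2) ≤ ENNReal.ofReal (y ^ r) * Measure.dirac r {r} := by
          simp only [Measure.dirac_apply_of_mem (Set.mem_singleton r), mul_one]
          exact ENNReal.ofReal_le_ofReal (by linarith)
      _ ≤ _ := by
        simp only [truncGeom, Measure.coe_add, Pi.add_apply, Measure.coe_smul, Pi.smul_apply,
          smul_eq_mul]
        exact le_add_self

/-- The levels are balanced: for every `l ≤ R` there are not too many arms of level at least `l`. -/
def Balanced {n : ℕ} (y : ℝ) (R : ℕ) (l : Fin n → ℕ) : Prop :=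
  ∀ j ≤ R, ((Finset.univ.filter fun i => j ≤ l i).card : ℝ) ≤ 4 * (R + 1) * (n * y ^ j)

/-- The expected number of arms of level at least `j` is `n y ^ j`. Markov's inequality with the
factor `4 (R + 1)` leaves room for a union bound over the `R + 1` values of `j`. -/
theorem levelLaw_not_balanced_le {n : ℕ} (hn : 0 < n) {y : ℝ} (h0 : 0 < y) (h1 : y ≤ 1) (R : ℕ) :
    levelLaw n (truncGeom y R) {l | ¬ Balanced y R l} ≤ 1 / 4 := by
  classical
  have := isProbabilityMeasure_truncGeom h0.le h1 R
  set c : ℕ → ℝ≥0∞ := fun j => ENNReal.ofReal (4 * (R + 1) * (n * y ^ j)) with hc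
  set N : ℕ → (Fin n → ℕ) → ℝ≥0∞ := fun j l => ∑ i, if j ≤ l i then 1 else 0 with hN
  have hn' : (0 : ℝ) < n := by exact_mod_cast hn
  have hpos : ∀ j, 0 < 4 * ((R : ℝ) + 1) * (n * y ^ j) := fun j => by positivity
  have hsub : {l | ¬ Balanced y R l} ⊆ ⋃ j ∈ Finset.range (R + 1), {l | c j ≤ N j l} := by
    intro l hl
    simp only [Balanced, Set.mem_ofPred_eq, not_forall] at hl
    obtain ⟨j, hj, h⟩ := hl
    push Not at h
    refine Set.mem_iUnion₂.2 ⟨j, Finset.mem_range.2 (by omega), ?_⟩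
    simp only [hc, hN, Set.mem_ofPred_eq, Finset.sum_boole]
    rw [← ENNReal.ofReal_natCast]
    exact ENNReal.ofReal_le_ofReal h.le
  have hone : ∀ j ∈ Finset.range (R + 1), levelLaw n (truncGeom y R) {l | c j ≤ N j l} ≤
      ENNReal.ofReal (1 / (4 * (R + 1))) := by
    intro j hj
    have hj : j ≤ R := by have := Finset.mem_range.1 hj; omega
    have hE : ∫⁻ l, N j l ∂(levelLaw n (truncGeom y R)) = ENNReal.ofReal (n * y ^ j) := by
      simp only [hN]
      rw [lintegral_finsetSum _ fun _ _ => Measurable.of_discrete]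
      have : ∀ i : Fin n, ∫⁻ l, (if j ≤ l i then 1 else 0) ∂(levelLaw n (truncGeom y R)) =
          ENNReal.ofReal (y ^ j) := by
        intro i
        have h2 := (measurePreserving_eval_infinitePi (fun _ : Fin n => truncGeom y R) i)
        have h3 := h2.measure_preimage (s := Set.Ici j) (MeasurableSet.of_discrete).nullMeasurableSet
        rw [truncGeom_Ici h0.le h1 hj] at h3
        rw [← h3, levelLaw, ← lintegral_indicator_one MeasurableSet.of_discrete]
        refine lintegral_congr fun l => ?_
        simp [Set.indicator_apply]
      rw [Finset.sum_congr rfl fun i _ => this i, Finset.sum_const, Finset.card_univ,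
        Fintype.card_fin, nsmul_eq_mul, ENNReal.ofReal_mul hn'.le, ENNReal.ofReal_natCast]
    refine (meas_ge_le_lintegral_div Measurable.of_discrete.aemeasurable ?_
      ENNReal.ofReal_ne_top).trans ?_
    · simpa [hc] using hpos j
    · rw [hE, ← ENNReal.ofReal_div_of_pos (hpos j)]
      refine ENNReal.ofReal_le_ofReal (le_of_eq ?_)
      have : (n : ℝ) * y ^ j ≠ 0 := by positivity
      field_simp
  refine (measure_mono hsub).trans ((measure_biUnion_finset_le _ _).trans
    ((Finset.sum_le_sum hone).trans (le_of_eq ?_)))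
  rw [Finset.sum_const, Finset.card_range, nsmul_eq_mul, ← ENNReal.ofReal_natCast,
    ← ENNReal.ofReal_mul (by positivity)]
  have : ((R + 1 : ℕ) : ℝ) * (1 / (4 * (R + 1))) = 1 / 4 := by
    push_cast
    field_simp
  rw [this, ENNReal.ofReal_div_of_pos (by norm_num)]
  simp

/-- The failure probability of an arm of level `l`. -/
def levelFail (y : unitInterval) (R l : ℕ) : unitInterval := y ^ min l R

/-- The thresholds before round `r` form a geometric series with sum at most `(4τ)^r / 2`, and an
arm of level `r` fails with probability `(4τ)^(-r)`. -/
theorem sum_levelFail_thresholds_le {τ : ℝ} (hτ : 1 ≤ τ) {y : unitInterval}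
    (hy : (y : ℝ) = (4 * τ)⁻¹) {R r : ℕ} (hr : r ≤ R) :
    ENNReal.ofReal (levelFail y R r) * ∑ r' ∈ Finset.range r, ENNReal.ofReal ((4 * τ) ^ r' * τ) ≤
      2⁻¹ := by
  have hb : (0 : ℝ) < 4 * τ := by linarith
  rw [← ENNReal.ofReal_sum_of_nonneg fun _ _ => by positivity,
    ← ENNReal.ofReal_mul (levelFail y R r).2.1]
  have h1 : ∀ r : ℕ, 4 * τ * ∑ r' ∈ Finset.range r, (4 * τ) ^ r' ≤ 2 * (4 * τ) ^ r := by
    intro r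
    induction r with
    | zero => simp
    | succ r ih =>
      rw [Finset.sum_range_succ, mul_add, pow_succ]
      have : 0 < (4 * τ) ^ r := by positivity
      nlinarith
  have h2 : ((levelFail y R r : unitInterval) : ℝ) = ((4 * τ) ^ r)⁻¹ := by
    rw [← inv_pow, ← hy]
    simp [levelFail, min_eq_left hr]
  have h3 : (levelFail y R r : ℝ) * ∑ r' ∈ Finset.range r, (4 * τ) ^ r' * τ ≤ 2⁻¹ := by
    rw [h2, ← Finset.sum_mul, inv_mul_le_iff₀ (by positivity)]
    linarith [h1 r]
  refine (ENNReal.ofReal_le_ofReal h3).trans (le_of_eq ?_)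
  rw [ENNReal.ofReal_inv_of_pos (by norm_num)]
  simp

/-! ### The two sides of the comparison on balanced instances. -/

/-- An algorithm that finds the best arm on all balanced instances in few rounds needs a lot of
time. -/
theorem NonAdaptiveAlg.le_time_of_output {K n : ℕ} (A : NonAdaptiveAlg K n) (hn : 0 < n) (T R : ℕ)
    (k : Fin K) {τ : ℝ} (hτ : 1 ≤ τ) {y : unitInterval} (hy : (y : ℝ) = (4 * τ)⁻¹)
    (H : ∀ l : Fin n → ℕ, Balanced y R l → ∀ b, 2⁻¹ ≤
      A.failLaw (Function.update (levelFail y R ∘ l) b 0)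
        {p | (A.run T p.1 p.2 R).2 k = some b}) :
    3 / 8 * (n : ℝ) ≤ 4 * (4 * τ) ^ R + 4 * R * (K * T / τ) := by
  have hb : (0 : ℝ) < 4 * τ := by linarith
  have hy0 : (0 : ℝ) < y := by rw [hy]; positivity
  have hy2 : (y : ℝ) ≤ 1 / 2 := by
    rw [hy, inv_le_comm₀ hb (by norm_num)]
    norm_num
    linarith
  have hy1 : (y : ℝ) ≤ 1 := by linarith
  have := isProbabilityMeasure_truncGeom hy0.le hy1 R
  set ρ := truncGeom y R with hρ
  have hinv : ∀ r ≤ R, 2 * (ρ {r})⁻¹ ≤ ENNReal.ofReal (4 * (4 * τ) ^ r) := by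
    intro r hr
    have h1 := le_truncGeom_singleton hy0.le hy2 hr
    have h2 : (ρ {r})⁻¹ ≤ ENNReal.ofReal (2 * (4 * τ) ^ r) := by
      refine (ENNReal.inv_le_inv.2 h1).trans (le_of_eq ?_)
      rw [← ENNReal.ofReal_inv_of_pos (by positivity), hy, inv_pow, inv_div, div_inv_eq_mul]
    calc 2 * (ρ {r})⁻¹ ≤ ENNReal.ofReal 2 * ENNReal.ofReal (2 * (4 * τ) ^ r) := by
          gcongr
          simp
      _ = _ := by
        rw [← ENNReal.ofReal_mul (by norm_num)]
        congr 1
        ring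
  have hupper := A.sum_lintegral_output_le T R k ρ
    (fun r hr => ((ENNReal.ofReal_pos.2 (by positivity)).trans_le
      (le_truncGeom_singleton hy0.le hy2 hr)).ne')
    (levelFail y R) (fun r => ENNReal.ofReal ((4 * τ) ^ r * τ))
    (fun r => (ENNReal.ofReal_pos.2 (by positivity)).ne') (fun r => ENNReal.ofReal_ne_top)
    (fun r hr => sum_levelFail_thresholds_le hτ hy hr)
  have hbal : 3 / 4 ≤ levelLaw n ρ {l | Balanced y R l} := by
    have h1 := levelLaw_not_balanced_le hn hy0 hy1 R
    have h2 : levelLaw n ρ {l | Balanced y R l} + levelLaw n ρ {l | ¬ Balanced y R l} = 1 := by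
      have := measure_add_measure_compl (μ := levelLaw n ρ) (s := {l | Balanced y R l})
        MeasurableSet.of_discrete
      rw [measure_univ] at this
      exact this
    have h3 : (3 / 4 : ℝ≥0∞) + 1 / 4 = 1 := by
      rw [← ENNReal.add_div, show (3 : ℝ≥0∞) + 1 = 4 by norm_num]
      exact ENNReal.div_self (by simp) (by simp)
    have h4 : (3 / 4 : ℝ≥0∞) + 1 / 4 ≤ levelLaw n ρ {l | Balanced y R l} + 1 / 4 :=
      (h3.trans h2.symm).le.trans (add_le_add le_rfl h1)
    exact (ENNReal.add_le_add_iff_right (by finiteness)).1 h4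
  -- Each `b` contributes success probability `1/2` on a set of levels of probability at least
  -- `3/4`.
  have hlower : ENNReal.ofReal (3 / 8 * n) ≤ ∑ b, ∫⁻ l,
      A.failLaw (Function.update (levelFail y R ∘ l) b 0)
        {p | (A.run T p.1 p.2 R).2 k = some b} ∂(levelLaw n ρ) := by
    have h1 : ∀ b, ENNReal.ofReal (3 / 8) ≤ ∫⁻ l,
        A.failLaw (Function.update (levelFail y R ∘ l) b 0)
          {p | (A.run T p.1 p.2 R).2 k = some b} ∂(levelLaw n ρ) := by
      intro b
      calc ENNReal.ofReal (3 / 8) = 2⁻¹ * (3 / 4) := by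
            rw [show (3 / 8 : ℝ) = 2⁻¹ * (3 / 4) by norm_num, ENNReal.ofReal_mul (by norm_num),
              ENNReal.ofReal_inv_of_pos (by norm_num), ENNReal.ofReal_div_of_pos (by norm_num)]
            simp
        _ ≤ 2⁻¹ * levelLaw n ρ {l | Balanced y R l} := by gcongr
        _ = ∫⁻ _ in {l | Balanced y R l}, 2⁻¹ ∂(levelLaw n ρ) := (setLIntegral_const _ _).symm
        _ ≤ ∫⁻ l in {l | Balanced y R l}, A.failLaw (Function.update (levelFail y R ∘ l) b 0)
              {p | (A.run T p.1 p.2 R).2 k = some b} ∂(levelLaw n ρ) :=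
            setLIntegral_mono Measurable.of_discrete fun l hl => H l hl b
        _ ≤ _ := setLIntegral_le_lintegral _ _
    calc ENNReal.ofReal (3 / 8 * n) = ∑ _b : Fin n, ENNReal.ofReal (3 / 8) := by
          rw [Finset.sum_const, Finset.card_univ, Fintype.card_fin, nsmul_eq_mul, mul_comm,
            ENNReal.ofReal_mul (by positivity), ENNReal.ofReal_natCast]
      _ ≤ _ := Finset.sum_le_sum fun b _ => h1 b
  -- The conditioning cost `4 (4τ)^r` cancels against the threshold `(4τ)^r τ`, so every round
  -- contributes the same amount.
  have hterm : ∀ r ∈ Finset.range R,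
      2 * (ρ {r})⁻¹ * ((K : ℝ≥0∞) * T / ENNReal.ofReal ((4 * τ) ^ r * τ)) ≤
        ENNReal.ofReal (4 * (K * T / τ)) := by
    intro r hr
    have h1 : (K : ℝ≥0∞) * T / ENNReal.ofReal ((4 * τ) ^ r * τ) =
        ENNReal.ofReal (K * T / ((4 * τ) ^ r * τ)) := by
      rw [ENNReal.ofReal_div_of_pos (by positivity),
        ENNReal.ofReal_mul (p := (K : ℝ)) (by positivity), ENNReal.ofReal_natCast, ENNReal.ofReal_natCast]
    calc _ ≤ ENNReal.ofReal (4 * (4 * τ) ^ r) * ENNReal.ofReal (K * T / ((4 * τ) ^ r * τ)) := by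
          rw [h1]
          gcongr
          exact hinv r (Finset.mem_range.1 hr).le
      _ = _ := by
        rw [← ENNReal.ofReal_mul (by positivity)]
        congr 1
        field_simp
  have hfinal : ENNReal.ofReal (3 / 8 * n) ≤
      ENNReal.ofReal (4 * (4 * τ) ^ R + 4 * R * (K * T / τ)) := by
    refine hlower.trans (hupper.trans ?_)
    rw [ENNReal.ofReal_add (by positivity) (by positivity)]
    refine add_le_add (hinv R le_rfl) ((Finset.sum_le_sum hterm).trans (le_of_eq ?_))
    rw [Finset.sum_const, Finset.card_range, nsmul_eq_mul, ← ENNReal.ofReal_natCast,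
      ← ENNReal.ofReal_mul (by positivity)]
    congr 1
    ring
  exact (ENNReal.ofReal_le_ofReal_iff (by positivity)).1 hfinal

/-- Successive Rejects is reliable on balanced instances. -/
theorem error_successiveRejects_balanced_le {n T R : ℕ} (hn : 2 ≤ n) (hn0 : 0 < n) (hT : n ≤ T)
    (y : unitInterval) (hy : (0 : ℝ) < y) (l : Fin n → ℕ) (hl : Balanced y R l) (b : Fin n) {Λ : ℝ}
    (hΛ : 0 ≤ Λ) (hW : 8 * (R + 1) * n * Λ * SR.logBar n ≤ (T : ℝ) - n)
    (q : Fin n → unitInterval) (hq : q = Function.update (levelFail y R ∘ l) b 0)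
    (hb : q b = 0) (hq0 : ∀ i ≠ b, 0 < q i) :
    (successiveRejects n hn0).error (failInstance b q hb hq0) T ≤
      ENNReal.ofReal (n * Real.exp (-Λ)) := by
  have hqi : ∀ i ≠ b, ((q i : unitInterval) : ℝ) = (y : ℝ) ^ min (l i) R := by
    intro i hi
    simp [hq, Function.update_of_ne hi, levelFail]
  -- After `Λ / q i` pulls arm `i` has not failed with probability at most `exp (-Λ)`. The value at
  -- `b`, where the division is by zero, plays no role.
  refine (error_successiveRejects_le hn hn0 hT b q hb hq0 (fun i => ⌈Λ / q i⌉₊) ?_).trans ?_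
  · intro k hk S hbS hcard
    have hcard' : (S.erase b).card = n - k - 1 := by rw [Finset.card_erase_of_mem hbS, hcard]
    -- An active arm of least level, levels above `R` acting as `R`. All other active arms except
    -- `b` have at least this level, so balance bounds their number, and hence `n - k`, in terms of
    -- `q i`.
    obtain ⟨i, hi, hmin⟩ := (S.erase b).exists_min_image (fun i => min (l i) R)
      (Finset.card_pos.1 (by omega))
    obtain ⟨hib, hiS⟩ := Finset.mem_erase.1 hi
    refine ⟨i, hiS, hib, ?_⟩
    have hpow : 0 < (y : ℝ) ^ min (l i) R := by positivity
    have h1 : ((S.erase b).card : ℝ) ≤ 4 * (R + 1) * (n * (y : ℝ) ^ min (l i) R) := by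
      refine le_trans ?_ (hl (min (l i) R) (min_le_right _ _))
      exact_mod_cast Finset.card_le_card fun j hj =>
        Finset.mem_filter.2 ⟨Finset.mem_univ j, (hmin j hj).trans (min_le_left _ _)⟩
    -- At least two arms are active, so leaving out `b` costs at most a factor 2; this turns the 4
    -- of `Balanced` into the 8 of `hW`.
    have h2 : (n : ℝ) - k ≤ 2 * (S.erase b).card := by
      have : n ≤ 2 * (S.erase b).card + k := by omega
      have : (n : ℝ) ≤ 2 * (S.erase b).card + k := by exact_mod_cast this
      linarith
    have hk' : (0 : ℝ) < (n : ℝ) - k := by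
      have : (k : ℝ) < n := by exact_mod_cast (by omega : k < n)
      linarith
    have h3 : (n : ℝ) + 1 - ((k + 1 : ℕ) : ℝ) = n - k := by push_cast; ring
    rw [SR.cum, if_neg k.succ_ne_zero, h3]
    refine Nat.ceil_mono ?_
    rw [hqi i hib, div_le_div_iff₀ hpow (mul_pos SR.logBar_pos hk')]
    calc Λ * (SR.logBar n * ((n : ℝ) - k))
        ≤ Λ * (SR.logBar n * (2 * (4 * (R + 1) * (n * (y : ℝ) ^ min (l i) R)))) := by
          have := SR.logBar_pos (n := n)
          gcongr
          linarith
      _ = 8 * (R + 1) * n * Λ * SR.logBar n * (y : ℝ) ^ min (l i) R := by ring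
      _ ≤ _ := by gcongr
  · have h1 : ∀ i ∈ Finset.univ.erase b,
        ENNReal.ofReal (1 - q i) ^ ⌈Λ / (q i : ℝ)⌉₊ ≤ ENNReal.ofReal (Real.exp (-Λ)) := by
      intro i hi
      have hpos : (0 : ℝ) < q i := hq0 i (Finset.ne_of_mem_erase hi)
      have h1q : (0 : ℝ) ≤ 1 - q i := by linarith [(q i).2.2]
      rw [← ENNReal.ofReal_pow h1q]
      refine ENNReal.ofReal_le_ofReal ?_
      calc (1 - (q i : ℝ)) ^ ⌈Λ / (q i : ℝ)⌉₊
          ≤ Real.exp (-(q i : ℝ)) ^ ⌈Λ / (q i : ℝ)⌉₊ :=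
            pow_le_pow_left₀ h1q (Real.one_sub_le_exp_neg _) _
        _ = Real.exp (-(⌈Λ / (q i : ℝ)⌉₊ * (q i : ℝ))) := by
            rw [← Real.exp_nat_mul]
            congr 1
            ring
        _ ≤ Real.exp (-Λ) := by
            refine Real.exp_le_exp.2 (neg_le_neg ?_)
            rw [← div_le_iff₀ hpos]
            exact Nat.le_ceil _
    refine (Finset.sum_le_sum h1).trans ?_
    rw [Finset.sum_const, nsmul_eq_mul, ENNReal.ofReal_mul (by positivity), ENNReal.ofReal_natCast]
    gcongr
    exact (Finset.card_erase_le).trans (by simp)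

/-! ### Numerical estimates and the choice of parameters. -/

theorem SR.logBar_le {n : ℕ} (hn : 1 ≤ n) : SR.logBar n ≤ 1 / 2 + Real.log n := by
  have h1 := harmonic_le_one_add_log n
  rw [harmonic_eq_sum_Icc] at h1
  push_cast at h1
  rw [← Finset.add_sum_Ioc_eq_sum_Icc hn] at h1
  have h2 : Finset.Ioc 1 n = Finset.Icc 2 n := by ext; simp; omega
  rw [h2] at h1
  simp only [SR.logBar, one_div]
  norm_num at h1 ⊢
  linarith

/-- This keeps `ln ln n` away from zero for all `n ≥ 3`, so that the denominator in the theorem is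
positive. -/
theorem lt_log_three : (1.05 : ℝ) < Real.log 3 := by
  have h1 : Real.log (3 / Real.exp 1) = Real.log 3 - 1 := by
    rw [Real.log_div (by norm_num) (Real.exp_pos 1).ne', Real.log_exp]
  have h2 := Real.one_sub_inv_le_log_of_pos (show (0 : ℝ) < 3 / Real.exp 1 by positivity)
  rw [h1, inv_div] at h2
  have := Real.exp_one_lt_d9
  linarith

theorem exists_instance {n : ℕ} (hn : 0 < n) : Nonempty (Instance n) :=
  ⟨failInstance ⟨0, hn⟩ (Function.update (fun _ => 1) ⟨0, hn⟩ 0) (by simp)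
    fun i hi => by rw [Function.update_of_ne hi]; exact zero_lt_one⟩

theorem le_benchmarkTime {n : ℕ} {α : ℝ} (hα : 1 ≤ α) (hL : 80 < Real.log n) :
    (n : ℝ) * (Real.log n ^ 3 * 6400) ≤ benchmarkTime n α := by
  refine le_trans ?_ (Nat.le_ceil _)
  set L := Real.log n
  have h2 : (6400 : ℝ) ≤ L ^ 2 := by nlinarith
  have h3 : L ≤ α * L ^ 10 := by
    calc L = 1 * L ^ 1 := by ring
      _ ≤ α * L ^ 10 := by
        gcongr
        · linarith
        · norm_num
  have h4 : (6400 : ℝ) ≤ (α * L ^ 10) ^ 2 := h2.trans (by gcongr)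
  rw [← mul_assoc]
  gcongr

theorem benchmarkTime_le {n : ℕ} (hn : 3 ≤ n) {α : ℝ} (hα : 1 ≤ α) (hL : 1 ≤ Real.log n) :
    (benchmarkTime n α : ℝ) ≤ 2 * (n * Real.log n ^ 23 * α ^ 2) := by
  have hnR : (3 : ℝ) ≤ n := by exact_mod_cast hn
  have h1 : (1 : ℝ) ≤ n * Real.log n ^ 23 * α ^ 2 :=
    one_le_mul_of_one_le_of_one_le
      (one_le_mul_of_one_le_of_one_le (by linarith) (one_le_pow₀ hL)) (one_le_pow₀ hα)
  have h2 : (n : ℝ) * Real.log n ^ 3 * (α * Real.log n ^ 10) ^ 2 =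
      n * Real.log n ^ 23 * α ^ 2 := by ring
  rw [benchmarkTime, h2]
  exact (Nat.ceil_lt_add_one (by linarith)).le.trans (by linarith)

/-- The round lower bound for algorithms that dominate Successive Rejects at one time budget. -/
theorem NonAdaptiveAlg.exists_expectedRounds_ge {K n : ℕ} (hn : 3 ≤ n) (hn0 : 0 < n) {α : ℝ}
    (hα : 1 ≤ α) (hK : 1 ≤ K) (A : NonAdaptiveAlg K n) (T : ℕ)
    (hdom : Dominates A T (successiveRejects n hn0) (benchmarkTime n α))
    (hT : (K / α) * T ≤ benchmarkTime n α) :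
    ∃ I : Instance n, ENNReal.ofReal
      (1 / 1000 * (Real.log n / (Real.log (Real.log n) + Real.log α))) ≤ A.expectedRounds I T := by
  set L := Real.log n with hL
  set D := Real.log L + Real.log α with hD
  have hnR : (3 : ℝ) ≤ n := by exact_mod_cast hn
  have hL3 : 1.05 < L := lt_log_three.trans_le (Real.log_le_log (by norm_num) hnR)
  have hlogL : 1 - L⁻¹ ≤ Real.log L := Real.one_sub_inv_le_log_of_pos (by linarith)
  have hlogα : 0 ≤ Real.log α := Real.log_nonneg hα
  have hLinv : L⁻¹ ≤ 1.05⁻¹ := inv_anti₀ (by norm_num) hL3.le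
  have hD0 : 1 / 25 < D := by
    have : (1.05 : ℝ)⁻¹ < 0.96 := by norm_num
    linarith
  -- A claimed bound of at most 1 is trivial, as every run has a round. Otherwise `ln n` exceeds
  -- 1000 times the denominator, which makes it large and in turn improves the lower bound on the
  -- denominator.
  by_cases hsmall : 1 / 1000 * (L / D) ≤ 1
  · obtain ⟨I⟩ := exists_instance hn0
    refine ⟨I, le_trans ?_ (A.one_le_expectedRounds hK I T)⟩
    rw [← ENNReal.ofReal_one]
    exact ENNReal.ofReal_le_ofReal hsmall
  push Not at hsmall
  have hLD : 1000 * D < L := by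
    have h1 : 1000 < L / D := by linarith
    rwa [lt_div_iff₀ (by linarith)] at h1
  have hL40 : 40 < L := by linarith
  have hL80 : 80 < L := by
    have : L⁻¹ ≤ 40⁻¹ := inv_anti₀ (by norm_num) hL40.le
    linarith
  have hD1 : 1 / 2 < D := by
    have : L⁻¹ ≤ 40⁻¹ := inv_anti₀ (by norm_num) hL40.le
    linarith
  have hexpL : Real.exp L = n := Real.exp_log (by linarith)
  by_contra hcon
  push Not at hcon
  -- The 52 is `2 · 26`: since `4 G^25 ≤ G^26` and `ln G = D`, it gives `(4τ)^R ≤ exp (26 R D) ≤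
  -- √n`.
  set R := ⌊L / (52 * D)⌋₊ with hR
  have hR1 : (R : ℝ) ≤ L / (52 * D) := Nat.floor_le (by positivity)
  have hR2 : L / (52 * D) < R + 1 := Nat.lt_floor_add_one _
  have hRL : (R : ℝ) * (52 * D) ≤ L := by rwa [le_div_iff₀ (by linarith)] at hR1
  have hR0 : (0 : ℝ) ≤ R := Nat.cast_nonneg R
  have hRL' : (R : ℝ) + 1 ≤ L := by nlinarith
  set G := α * L with hG
  have hGL : L ≤ G := by nlinarith
  have hlogG : Real.log G = D := by
    rw [hG, Real.log_mul (by linarith) (by linarith), hD, add_comm]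
  have hG1 : 1 ≤ G := by linarith
  have hτ1 : 1 ≤ G ^ 25 := one_le_pow₀ hG1
  have hβ : (4 * G ^ 25) ^ R ≤ Real.exp (L / 2) := by
    have h1 : 4 * G ^ 25 ≤ G ^ 26 := by
      rw [pow_succ G 25]
      nlinarith
    calc (4 * G ^ 25) ^ R ≤ (G ^ 26) ^ R := pow_le_pow_left₀ (by positivity) h1 R
      _ = Real.exp (26 * R * D) := by
        rw [← hlogG, ← pow_mul, ← Real.rpow_natCast, Real.rpow_def_of_pos (by linarith)]
        push_cast
        ring_nf
      _ ≤ _ := Real.exp_le_exp.2 (by linarith)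
  have hβ' : 4 * (4 * G ^ 25) ^ R ≤ n / 8 := by
    have h1 : (41 : ℝ) ≤ Real.exp (L / 2) := by linarith [Real.add_one_le_exp (L / 2)]
    have h2 : (n : ℝ) = Real.exp (L / 2) * Real.exp (L / 2) := by
      rw [← Real.exp_add, add_halves, hexpL]
    nlinarith
  set W := benchmarkTime n α with hW
  have hα0 : 0 < α := by linarith
  have hWn : (n : ℝ) * (L ^ 3 * 6400) ≤ W := le_benchmarkTime hα hL80
  have hL3' : 1 ≤ L ^ 3 := one_le_pow₀ (by linarith)
  have hn1 : (n : ℝ) ≤ n * L ^ 3 := le_mul_of_one_le_right (by linarith) hL3'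
  have hWn' : n ≤ W := by
    have : (n : ℝ) ≤ W := by linarith
    exact_mod_cast this
  -- Here `Λ = 2 ln n`, for which the error bound `n exp (-Λ)` is `1 / n`.
  have hSR : 8 * ((R : ℝ) + 1) * n * (2 * L) * SR.logBar n ≤ (W : ℝ) - n := by
    have h1 : SR.logBar n ≤ 2 * L := (SR.logBar_le (by omega)).trans (by linarith)
    calc 8 * ((R : ℝ) + 1) * n * (2 * L) * SR.logBar n ≤ 8 * L * n * (2 * L) * (2 * L) := by
          have := SR.logBar_pos (n := n)
          gcongr
      _ = n * (L ^ 3 * 32) := by ring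
      _ ≤ n * (L ^ 3 * 6400) - n := by linarith
      _ ≤ _ := by linarith
  have hKT : (K : ℝ) * T ≤ 2 * n * L ^ 23 * α ^ 3 := by
    have h1 : (K : ℝ) * T ≤ α * W := by
      rw [div_mul_eq_mul_div, div_le_iff₀ hα0] at hT
      linarith
    calc (K : ℝ) * T ≤ α * W := h1
      _ ≤ α * (2 * (n * L ^ 23 * α ^ 2)) := by
        gcongr
        exact benchmarkTime_le hn hα (by linarith)
      _ = _ := by ring
  -- The exponent 25 in `τ = G^25` comes from here: `R K T` is of order `n L^24 α^3`, and one spare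
  -- factor `L > 80` absorbs the constant 64.
  have hKT' : 4 * (R : ℝ) * (K * T / G ^ 25) ≤ n / 8 := by
    have h1 : 4 * (R : ℝ) * (K * T) ≤ n / 8 * G ^ 25 := by
      have hα3 : α ^ 3 ≤ α ^ 25 := pow_le_pow_right₀ hα (by norm_num)
      calc 4 * (R : ℝ) * (K * T) ≤ 4 * L * (2 * n * L ^ 23 * α ^ 3) := by gcongr; linarith
        _ = n / 8 * (64 * L ^ 24 * α ^ 3) := by ring
        _ ≤ n / 8 * (L * L ^ 24 * α ^ 25) := by gcongr; linarith
        _ = _ := by rw [hG]; ring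
    rw [← mul_div_assoc, div_le_iff₀ (by positivity)]
    exact h1
  let y : unitInterval := ⟨(4 * G ^ 25)⁻¹, by positivity, inv_le_one_of_one_le₀ (by linarith)⟩
  have hy0 : (0 : ℝ) < y := by change (0 : ℝ) < (4 * G ^ 25)⁻¹; positivity
  have hcore := A.le_time_of_output hn0 T R ⟨0, hK⟩ hτ1 (y := y) rfl ?_
  -- Both terms are at most `n / 8`, which contradicts the lower bound `3 n / 8`.
  · linarith
  intro l hl b
  set q := Function.update (levelFail y R ∘ l) b 0 with hq
  have hqb : q b = 0 := by simp [hq]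
  have hq0 : ∀ i ≠ b, 0 < q i := by
    intro i hi
    rw [hq, Function.update_of_ne hi]
    exact pow_pos (show 0 < y from hy0) _
  have herr := (hdom (failInstance b q hqb hq0)).trans
    (error_successiveRejects_balanced_le (by omega) hn0 hWn' y hy0 l hl b (by linarith) hSR q hq
      hqb hq0)
  have hquarter : ENNReal.ofReal (1 / 4) = 4⁻¹ := by
    rw [one_div, ENNReal.ofReal_inv_of_pos (by norm_num)]
    simp
  have herr' : A.error (failInstance b q hqb hq0) T ≤ 4⁻¹ := by
    refine herr.trans ?_
    rw [← hquarter]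
    refine ENNReal.ofReal_le_ofReal ?_
    have h1 : (n : ℝ) * Real.exp (-(2 * L)) = Real.exp (-L) := by
      rw [← hexpL, ← Real.exp_add]
      congr 1
      ring
    rw [h1, Real.exp_neg, one_div]
    refine inv_anti₀ (by norm_num) ?_
    linarith [Real.add_one_le_exp L]
  -- As `R + 1 > L / (52 D)`, the quotient is at most `52 / 1000`. With the error at most `1/4`,
  -- success within `R` rounds keeps probability at least `1/2`.
  have hrounds : A.expectedRounds (failInstance b q hqb hq0) T / ((R : ℝ≥0∞) + 1) ≤ 4⁻¹ := by
    refine ENNReal.div_le_of_le_mul ((hcon _).le.trans ?_)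
    have h1 : ((R : ℝ≥0∞) + 1) = ENNReal.ofReal (R + 1) := by
      rw [ENNReal.ofReal_add hR0 zero_le_one, ENNReal.ofReal_natCast, ENNReal.ofReal_one]
    rw [h1, ← hquarter, ← ENNReal.ofReal_mul (by norm_num)]
    refine ENNReal.ofReal_le_ofReal ?_
    have h2 : L / D = 52 * (L / (52 * D)) := by field_simp
    rw [h2]
    linarith
  have hone := A.one_le_measure_output (failInstance b q hqb hq0) T R ⟨0, hK⟩
  have h4 : (2⁻¹ : ℝ≥0∞) + 2⁻¹ ≤
      A.failLaw q {p | (A.run T p.1 p.2 R).2 ⟨0, hK⟩ = some b} + 2⁻¹ := by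
    have h5 : (4⁻¹ : ℝ≥0∞) + 4⁻¹ = 2⁻¹ := by
      rw [← hquarter, ← ENNReal.ofReal_add (by norm_num) (by norm_num),
        show (1 / 4 : ℝ) + 1 / 4 = 2⁻¹ by norm_num, ENNReal.ofReal_inv_of_pos (by norm_num)]
      simp
    rw [ENNReal.inv_two_add_inv_two]
    refine hone.trans ?_
    rw [add_assoc, ← h5]
    exact add_le_add le_rfl (add_le_add herr' hrounds)
  exact (ENNReal.add_le_add_iff_right (by simp)).1 h4

theorem benchmarkTime_pos {n : ℕ} (hn : 3 ≤ n) {α : ℝ} (hα : 1 ≤ α) : 0 < benchmarkTime n α := by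
  have hnR : (3 : ℝ) ≤ n := by exact_mod_cast hn
  have : 0 < Real.log n := Real.log_pos (by linarith)
  have : 0 < α := by linarith
  exact Nat.ceil_pos.2 (by positivity)

/-- A large speedup provides a comparison with every centralized algorithm. -/
theorem NonAdaptiveAlg.exists_dominates_of_le_speedup {K n : ℕ} (A : NonAdaptiveAlg K n) {x : ℝ}
    (hx : 0 < x) (h : ENNReal.ofReal x ≤ speedup A) (O : CentralizedAlg n) {W : ℕ} (hW : 0 < W) :
    ∃ T, Dominates A T O W ∧ x * T ≤ W := by
  classical
  have h1 : ENNReal.ofReal x ≤ ⨆ (T : ℕ) (_ : Dominates A T O W), (W : ℝ≥0∞) / (T : ℝ≥0∞) :=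
    h.trans ((iInf_le _ W).trans ((iInf_le _ hW).trans (iInf_le _ O)))
  have hex : ∃ T, Dominates A T O W := by
    by_contra hne
    push Not at hne
    simp only [hne, iSup_false, iSup_const, bot_eq_zero, nonpos_iff_eq_zero,
      ENNReal.ofReal_eq_zero] at h1
    linarith
  -- The supremum of `W / T` is attained at the least dominating budget; one exists because the
  -- empty supremum `0` is below `x`.
  refine ⟨Nat.find hex, Nat.find_spec hex, ?_⟩
  have h2 : ENNReal.ofReal x ≤ (W : ℝ≥0∞) / (Nat.find hex : ℝ≥0∞) := by
    refine h1.trans (iSup₂_le fun T hT => ?_)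
    gcongr
    exact Nat.find_min' hex hT
  have h3 : ENNReal.ofReal x * (Nat.find hex : ℝ≥0∞) ≤ W :=
    ENNReal.mul_le_of_le_div h2
  rw [← ENNReal.ofReal_natCast, ← ENNReal.ofReal_mul hx.le, ← ENNReal.ofReal_natCast] at h3
  exact (ENNReal.ofReal_le_ofReal_iff (by positivity)).1 h3

end BestArm

end

theorem theorem1 :
    ∃ c : ℝ, 0 < c ∧ ∀ (n : ℕ) (hn : 3 ≤ n) (α : ℝ), 1 ≤ α → α ≤ (n : ℝ) ^ (0.2 : ℝ) →
      ∀ (K : ℕ), 1 ≤ K → ∀ A : BestArm.NonAdaptiveAlg K n,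
        (ENNReal.ofReal (K / α) ≤ BestArm.speedup A →
          ∃ (T : ℕ) (I : BestArm.Instance n),
            ENNReal.ofReal (c * (Real.log n / (Real.log (Real.log n) + Real.log α))) ≤
              A.expectedRounds I T) ∧
        (∀ T' : ℕ,
          BestArm.Dominates A T' (BestArm.successiveRejects n (by omega))
            (BestArm.benchmarkTime n α) →
          (K / α) * T' ≤ BestArm.benchmarkTime n α →
          ∃ I : BestArm.Instance n,
            ENNReal.ofReal (c * (Real.log n / (Real.log (Real.log n) + Real.log α))) ≤
              A.expectedRounds I T') := by
  refine ⟨1 / 1000, by norm_num, fun n hn α hα _ K hK A => ⟨fun h => ?_, fun T hdom hT => ?_⟩⟩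
  · have hK' : (0 : ℝ) < K := by exact_mod_cast hK
    obtain ⟨T, hdom, hT⟩ := A.exists_dominates_of_le_speedup (div_pos hK' (by linarith)) h
      (BestArm.successiveRejects n (by omega)) (BestArm.benchmarkTime_pos hn hα)
    exact ⟨T, A.exists_expectedRounds_ge hn (by omega) hα hK T hdom hT⟩
  · exact A.exists_expectedRounds_ge hn (by omega) hα hK T hdom hT
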